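/- Let $\mathcal G\rightrightarrows M$ be a Lie groupoid: a small category with invertible arrows whose base $M$ is a Hausdorff, second-countable smooth manifold, whose arrow space $\mathcal G$ is a smooth manifold (not necessarily Hausdorff or second-countable), whose structure maps are smooth, and whose source map $s$ is a smooth submersion with Hausdorff fibers; let $t$ be its target map. The orbit of $x\in M$ is $t(s^{-1}(x))$, with the canonical smooth structure induced from $s^{-1}(x)$ by $t$ (its topology is the quotient topology). Let $\mathcal F$ be the induced singular foliation of $M$, that is, the partition of $M$ into the connected components $L$ (the leaves) of the orbits, and let $\Delta_x=T_xL\subseteq T_xM$, where $L$ is the leaf through $x$. Let $\mathcal G^\circ\rightrightarrows M$ be the source-connected identity component of $\mathcal G$: the open subgroupoid of all arrows $g$ such that $g$ and $1_{s(g)}$ lie in the same connected component of $s^{-1}(s(g))$. A smooth differential form $\alpha\in\Omega^k(M)$ ($k\ge 0$) is called $\mathcal G$-basic if $s^*\alpha=t^*\alpha$ on $\mathcal G$; it is called $\mathcal G^\circ$-basic if $s^*\alpha=t^*\alpha$ on $\mathcal G^\circ$; and it is called $\mathcal F$-basic if $\iota_X\alpha=0$ and $\mathcal L_X\alpha=0$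 for every smooth vector field $X$, defined on an open subset of $M$, with $X_y\in\Delta_y$ for all $y$ in its domain. Then every $\mathcal G$-basic form is $\mathcal F$-basic, and every $\mathcal F$-basic form is $\mathcal G^\circ$-basic. Hence, if all source fibers of $\mathcal G$ are connected, a form is $\mathcal G$-basic if and only if it is $\mathcal F$-basic. -/

import Mathlib

open scoped Manifold ContDiff

noncomputable section

namespace SingFol

/-! ### Differential forms on manifolds -/

section Forms

variable {E : Type*} [NormedAddCommGroup E] [NormedSpace ℝ E]
  {M : Type*} [TopologicalSpace M] [ChartedSpace E M]

/-- A (not necessarily smooth) real differential `k`-form on `M`: an alternating `k`-linear form on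
each tangent space. -/
abbrev Form (E : Type*) [NormedAddCommGroup E] [NormedSpace ℝ E]
    (M : Type*) [TopologicalSpace M] [ChartedSpace E M] (k : ℕ) : Type _ :=
  ∀ x : M, TangentSpace 𝓘(ℝ, E) x [⋀^Fin k]→L[ℝ] ℝ

/-- The coordinate expression of a form in the chart `e`: its pullback by the inverse chart. It is
meaningful on `e.target`. -/
def Form.inChart {k : ℕ} (α : Form E M k) (e : OpenPartialHomeomorph M E) :
    E → E [⋀^Fin k]→L[ℝ] ℝ :=
  fun y => (α (e.symm y)).compContinuousLinearMap (mfderiv 𝓘(ℝ, E) 𝓘(ℝ, E) e.symm y)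

/-- A form is smooth if its coordinate expressions are. -/
def Form.IsSmooth {k : ℕ} (α : Form E M k) : Prop :=
  ∀ e ∈ atlas E M, ContDiffOn ℝ ∞ (α.inChart e) e.target

/-- The exterior derivative of a form, computed at each point `x` in the preferred chart at `x`. -/
def Form.d {k : ℕ} (α : Form E M k) : Form E M (k + 1) :=
  fun x => (extDeriv (α.inChart (chartAt E x)) (chartAt E x x)).compContinuousLinearMap
    (mfderiv 𝓘(ℝ, E) 𝓘(ℝ, E) (chartAt E x) x)

/-- The contraction `ι_X α` of a form of positive degree with a vector field: `X` is inserted in the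
first slot. -/
def Form.contract {k : ℕ} (X : ∀ x : M, TangentSpace 𝓘(ℝ, E) x) (α : Form E M (k + 1)) :
    Form E M k :=
  fun x => ContinuousAlternatingMap.curryLeft (E := E) (α x) (X x)

/-- `ι_X α = 0` at the point `x`; for functions this holds by convention. -/
def Form.ContractVanishesAt (X : ∀ x : M, TangentSpace 𝓘(ℝ, E) x) (x : M) :
    ∀ {k : ℕ}, Form E M k → Prop
  | 0, _ => True
  | _ + 1, α => α.contract X x = 0

/-- The Lie derivative `L_X α = ι_X (dα) + d (ι_X α)`, where `ι_X α = 0` if `α` is a function. -/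
def Form.lieDeriv (X : ∀ x : M, TangentSpace 𝓘(ℝ, E) x) :
    ∀ {k : ℕ}, Form E M k → Form E M k
  | 0, α => α.d.contract X
  | _ + 1, α => fun x => α.d.contract X x + (α.contract X).d x

/-- The pullback of a form by a smooth map. -/
def Form.pullback {E' : Type*} [NormedAddCommGroup E'] [NormedSpace ℝ E']
    {N : Type*} [TopologicalSpace N] [ChartedSpace E' N] {k : ℕ} (f : N → M) (α : Form E M k) :
    Form E' N k :=
  fun x => (α (f x)).compContinuousLinearMap (mfderiv 𝓘(ℝ, E') 𝓘(ℝ, E) f x)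

/-! ### Singular foliations and their basic forms -/

/-- The tangent space at `x` of a subset `L` of `M`: the span of the velocities at `x` of the smooth
curves of `M` that lie in `L`. If `L` is a weakly embedded submanifold, then the smooth curves of
the manifold `L` are exactly the smooth curves of `M` that lie in `L`, so that this is the tangent
space of `L` at `x` for the unique manifold structure of `L`, seen inside the one of `M`. -/
def leafTangentSpace (E : Type*) [NormedAddCommGroup E] [NormedSpace ℝ E]
    {M : Type*} [TopologicalSpace M] [ChartedSpace E M] (L : Set M) (x : M) :
    Submodule ℝ (TangentSpace 𝓘(ℝ, E) x) :=
  Submodule.span ℝ {v | ∃ γ : ℝ → M, ContMDiff 𝓘(ℝ, ℝ) 𝓘(ℝ, E) ∞ γ ∧ (∀ t, γ t ∈ L) ∧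
    tangentMap 𝓘(ℝ, ℝ) 𝓘(ℝ, E) γ ⟨0, (1 : ℝ)⟩ = ⟨x, v⟩}

/-- The singular distribution of a partition `F` of `M` (a set of leaves): a vector at `x` belongs
to it if it is tangent to the leaf that contains `x`. -/
def distribution (E : Type*) [NormedAddCommGroup E] [NormedSpace ℝ E]
    {M : Type*} [TopologicalSpace M] [ChartedSpace E M] (F : Set (Set M)) (x : M) :
    Set (TangentSpace 𝓘(ℝ, E) x) :=
  {v | ∃ L ∈ F, x ∈ L ∧ v ∈ leafTangentSpace E L x}

/-- A form is `F`-basic if `ι_X α = 0` and `L_X α = 0` for all smooth vector fields `X`, defined on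
open subsets `U` of `M`, that are sections of the distribution of `F`. -/
def IsFoliationBasic [IsManifold 𝓘(ℝ, E) ∞ M] (F : Set (Set M)) {k : ℕ} (α : Form E M k) : Prop :=
  ∀ (U : Set M) (X : ∀ x : M, TangentSpace 𝓘(ℝ, E) x), IsOpen U →
    ContMDiffOn 𝓘(ℝ, E) (𝓘(ℝ, E).prod 𝓘(ℝ, E)) ∞
      (fun x => (⟨x, X x⟩ : TangentBundle 𝓘(ℝ, E) M)) U →
    (∀ x ∈ U, X x ∈ distribution E F x) →
    ∀ x ∈ U, α.ContractVanishesAt X x ∧ α.lieDeriv X x = 0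

end Forms

/-! ### Lie groupoids -/

/-- A Lie groupoid with base `M` (modelled on `E`) and arrow space `G` (modelled on `E'`).
An arrow `g` goes from `src g` to `tgt g`. The product `mul g h` is the arrow "`h`, then `g`"; it is
meaningful if `src g = tgt h`, and its values on other pairs carry no information. The arrow space
need not be Hausdorff or second countable, but the source fibers are Hausdorff. -/
structure LieGroupoid (E : Type*) [NormedAddCommGroup E] [NormedSpace ℝ E]
    (E' : Type*) [NormedAddCommGroup E'] [NormedSpace ℝ E']
    (M : Type*) [TopologicalSpace M] [ChartedSpace E M]
    (G : Type*) [TopologicalSpace G] [ChartedSpace E' G] where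
  /-- source -/
  src : G → M
  /-- target -/
  tgt : G → M
  /-- identity arrows -/
  unit : M → G
  /-- inversion -/
  inv : G → G
  /-- multiplication of composable arrows -/
  mul : G → G → G
  src_unit : ∀ x, src (unit x) = x
  tgt_unit : ∀ x, tgt (unit x) = x
  src_inv : ∀ g, src (inv g) = tgt g
  tgt_inv : ∀ g, tgt (inv g) = src g
  src_mul : ∀ g h, src g = tgt h → src (mul g h) = src h
  tgt_mul : ∀ g h, src g = tgt h → tgt (mul g h) = tgt g
  mul_assoc : ∀ g h k, src g = tgt h → src h = tgt k → mul (mul g h) k = mul g (mul h k)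
  unit_mul : ∀ g, mul (unit (tgt g)) g = g
  mul_unit : ∀ g, mul g (unit (src g)) = g
  inv_mul : ∀ g, mul (inv g) g = unit (src g)
  mul_inv : ∀ g, mul g (inv g) = unit (tgt g)
  submersion_src : Manifold.IsSubmersion 𝓘(ℝ, E') 𝓘(ℝ, E) ∞ src
  smooth_tgt : ContMDiff 𝓘(ℝ, E') 𝓘(ℝ, E) ∞ tgt
  smooth_unit : ContMDiff 𝓘(ℝ, E) 𝓘(ℝ, E') ∞ unit
  smooth_inv : ContMDiff 𝓘(ℝ, E') 𝓘(ℝ, E') ∞ inv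
  smooth_mul : ContMDiffOn (𝓘(ℝ, E').prod 𝓘(ℝ, E')) 𝓘(ℝ, E') ∞
    (fun p : G × G => mul p.1 p.2) {p | src p.1 = tgt p.2}
  t2_fiber : ∀ x, T2Space (src ⁻¹' {x})

namespace LieGroupoid

variable {E : Type*} [NormedAddCommGroup E] [NormedSpace ℝ E]
  {E' : Type*} [NormedAddCommGroup E'] [NormedSpace ℝ E']
  {M : Type*} [TopologicalSpace M] [ChartedSpace E M]
  {G : Type*} [TopologicalSpace G] [ChartedSpace E' G]
  (𝒢 : LieGroupoid E E' M G)

/-- The orbit of `x`: the targets of the arrows that start at `x`. -/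
def orbit (x : M) : Set M := 𝒢.tgt '' (𝒢.src ⁻¹' {x})

/-- The target map, from the source fiber of `x` onto the orbit of `x`. -/
def toOrbit (x : M) (g : 𝒢.src ⁻¹' {x}) : 𝒢.orbit x := ⟨𝒢.tgt g, g, g.2, rfl⟩

/-- The topology of the canonical manifold structure of the orbit of `x`, for which the target map
from the source fiber of `x` is a principal bundle: the quotient topology. -/
@[reducible] def orbitTopology (x : M) : TopologicalSpace (𝒢.orbit x) :=
  TopologicalSpace.coinduced (𝒢.toOrbit x) inferInstance

/-- The leaf through `x`: the connected component of `x` in its orbit, with respect to the canonical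
topology of the orbit. -/
def leaf (x : M) : Set M :=
  Subtype.val '' (@connectedComponent (𝒢.orbit x) (𝒢.orbitTopology x)
    (𝒢.toOrbit x ⟨𝒢.unit x, 𝒢.src_unit x⟩))

/-- The singular foliation induced by a Lie groupoid: the partition of the base into the connected
components of the orbits. -/
def foliation : Set (Set M) := Set.range 𝒢.leaf

/-- The arrows of the source-connected identity component `𝒢°`: the arrows `g` that lie in the same
connected component of their source fiber as the identity arrow of `src g`. -/
def identityComponent : Set G :=
  {g | g ∈ connectedComponentIn (𝒢.src ⁻¹' {𝒢.src g}) (𝒢.unit (𝒢.src g))}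

/-- All source fibers are connected. -/
def IsSourceConnected : Prop := ∀ x, IsConnected (𝒢.src ⁻¹' {x})

/-- `s^* α = t^* α` at all arrows in `A`. For an open subgroupoid with arrow space `A` (such as
`𝒢°`) this says that `α` is basic for that subgroupoid, since its tangent spaces are those of `G`
and its source and target are the restrictions of those of `𝒢`. -/
def IsBasicOn (A : Set G) {k : ℕ} (α : Form E M k) : Prop :=
  ∀ g ∈ A, Form.pullback (E' := E') 𝒢.src α g = Form.pullback (E' := E') 𝒢.tgt α g

/-- A form on the base is `𝒢`-basic if `s^* α = t^* α`. -/
def IsBasic {k : ℕ} (α : Form E M k) : Prop :=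
  Form.pullback (E' := E') 𝒢.src α = Form.pullback (E' := E') 𝒢.tgt α

end LieGroupoid

end SingFol

end

/-! Call a form horizontal if it is annihilated by `dt(a)` for all `a` in `ker ds`. Both
implications pass through the condition that `α` and `dα` are horizontal.

If `s^*α = t^*α`, then `α` is horizontal, because `ds` kills `a` and `dt` is surjective; since `d`
commutes with pullbacks, the same holds for `dα`. By Cartan's formula it remains to see that `α` and
`dα` annihilate the vectors tangent to leaves. These are spanned by velocities of smooth curves of
`M` that stay in a leaf, and no continuity in the topology of the leaf is given. Translations show
that `t` has constant rank on each source fiber, so locally it has a generalized inverse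
(`exists_generalizedInverse_of_constant_rank`, `exists_plaque`). By the Poincaré–Volterra theorem a
leaf is covered by countably many of the resulting plaques, so the times of a curve in it fall into
countably many sets. All but countably many times are accumulation points of a set containing them,
and there the velocity lies in `dt(ker ds)` (`dense_velocity_of_mem_leaf`). Continuity of `α` and
`dα` extends the annihilation to all times.

Conversely, near a unit each vector `dt(a)` extends to a local section of the distribution
(`exists_section_distribution`), so a form basic for the foliation is horizontal at units, together
with its derivative; translations carry this to all arrows. Then `s^*α` and `t^*α`, in charts
adapted to `s`, are constant along source fibers (`pullback_inChart_fiberMap`). Their agreement is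
thus open and closed on each source fiber; it holds at the unit, hence on the component of the unit.
-/

noncomputable section

open scoped Topology
open Set Filter

namespace SingFol

/-! ### The Poincaré–Volterra theorem -/

section PoincareVolterra

variable {X : Type*} [TopologicalSpace X]

/-- A separable set meets only countably many members of a disjoint family of open sets. -/
theorem countable_of_pairwiseDisjoint_of_isSeparable {W : Set X}
    (hW : TopologicalSpace.IsSeparable W) {A : Set (Set X)} (hA : A.PairwiseDisjoint id)
    (ho : ∀ s ∈ A, IsOpen s) (hne : ∀ s ∈ A, (s ∩ W).Nonempty) : A.Countable := by
  obtain ⟨c, hc, hWc⟩ := hW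
  have hmeet : ∀ s ∈ A, ∃ x ∈ c, x ∈ s := by
    intro s hs
    obtain ⟨x, hxs, hxW⟩ := hne s hs
    obtain ⟨y, hy, hyc⟩ := mem_closure_iff.1 (hWc hxW) s (ho s hs) hxs
    exact ⟨y, hyc, hy⟩
  rcases isEmpty_or_nonempty X with hX | hX
  · exact (subsingleton_of_subsingleton (s := A)).countable
  choose! g hgc hgs using hmeet
  refine MapsTo.countable_of_injOn (f := g) (t := c) (fun s hs => hgc s hs) ?_ hc
  intro s hs s' hs' h
  by_contra hne
  exact (disjoint_left.1 (hA hs hs' hne) (hgs s hs)) (h ▸ hgs s' hs')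

/-- A set of sets that is generated from one member by a countably branching relation is
countable. -/
theorem countable_setOf_reflTransGen {α : Type*} {r : α → α → Prop}
    (hr : ∀ a, {b | r a b}.Countable) (a : α) : {b | Relation.ReflTransGen r a b}.Countable := by
  let R : ℕ → Set α := fun n => Nat.rec {a} (fun _ S => ⋃ b ∈ S, {c | r b c}) n
  have hR : ∀ n, (R n).Countable := by
    intro n
    induction n with
    | zero => exact countable_singleton a
    | succ n ih => exact ih.biUnion fun b _ => hr b
  refine (countable_iUnion hR).mono fun b hb => ?_
  have hb : Relation.ReflTransGen r a b := hb
  induction hb with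
  | refl => exact mem_iUnion.2 ⟨0, rfl⟩
  | tail _ h ih =>
    obtain ⟨n, hn⟩ := mem_iUnion.1 (ih ‹_›)
    exact mem_iUnion.2 ⟨n + 1, mem_biUnion hn h⟩

variable {Y : Type*} [TopologicalSpace Y]

/-- If `f` is injective and continuous, then each neighborhood of a point contains the component at
this point of the preimage of some basic open set. -/
theorem exists_connectedComponentIn_preimage_subset [LocallyCompactSpace X] [T2Space Y] {f : X → Y}
    (hf : Continuous f) (hinj : Function.Injective f) {B : Set (Set Y)}
    (hB : TopologicalSpace.IsTopologicalBasis B) {Q : Set X} {p : X} (hQ : Q ∈ 𝓝 p) :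
    ∃ V ∈ B, f p ∈ V ∧ connectedComponentIn (f ⁻¹' V) p ⊆ Q := by
  have : T2Space X := T2Space.of_injective_continuous hinj hf
  obtain ⟨K, hK, hKQ, hKc⟩ := local_compact_nhds hQ
  -- By injectivity the compact image of the frontier misses `f p`, so some basic `V` around `f p`
  -- misses it too. A connected subset of `f ⁻¹' V` through `p` then cannot leave `K`.
  have hcomp : IsCompact (frontier K) :=
    hKc.of_isClosed_subset isClosed_frontier (hKc.isClosed.frontier_subset)
  have hp : p ∈ interior K := mem_interior_iff_mem_nhds.2 hK
  have hnot : f p ∉ f '' frontier K := by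
    rintro ⟨q, hq, hqp⟩
    rw [hinj hqp] at hq
    exact hq.2 hp
  obtain ⟨V, hVB, hpV, hV⟩ := hB.exists_subset_of_mem_open
    (show f p ∈ (f '' frontier K)ᶜ from hnot) (hcomp.image hf).isClosed.isOpen_compl
  refine ⟨V, hVB, hpV, fun q hq => hKQ ?_⟩
  have hpre : IsPreconnected (connectedComponentIn (f ⁻¹' V) p) :=
    isPreconnected_connectedComponentIn
  have hsub := connectedComponentIn_subset (f ⁻¹' V) p
  by_contra hqK
  obtain ⟨z, -, hzK, hzK'⟩ := hpre (interior K) Kᶜ isOpen_interior hKc.isClosed.isOpen_compl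
    (fun z hz => by
      by_contra hzK
      simp only [mem_union, mem_compl_iff, not_or, not_not] at hzK
      exact hV (hsub hz) ⟨z, ⟨subset_closure hzK.2, hzK.1⟩, rfl⟩)
    ⟨p, mem_connectedComponentIn hpV, hp⟩ ⟨q, hq, hqK⟩
  exact hzK' (interior_subset hzK)

/-- The Poincaré–Volterra theorem: if a locally compact, locally connected space is mapped
injectively and continuously to a second countable Hausdorff space, then its connected components
are covered by countably many members of each open cover by separable sets. -/
theorem exists_countable_cover_connectedComponent [LocallyCompactSpace X] [LocallyConnectedSpace X]
    [T2Space Y] [SecondCountableTopology Y] {f : X → Y}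
    (hf : Continuous f) (hinj : Function.Injective f) {ι : Type*} (Q : ι → Set X)
    (hQo : ∀ i, IsOpen (Q i)) (hQs : ∀ i, TopologicalSpace.IsSeparable (Q i))
    (hQ : ∀ x, ∃ i, x ∈ Q i) (p : X) :
    ∃ c : Set ι, c.Countable ∧ connectedComponent p ⊆ ⋃ i ∈ c, Q i := by
  obtain ⟨B, hBc, -, hB⟩ := TopologicalSpace.exists_countable_basis Y
  -- Being contained in some `Q i` makes the members of `𝔚` separable; being components in a locally
  -- connected space makes them open.
  let 𝔚 : Set (Set X) := {W | ∃ V ∈ B, ∃ x, W = connectedComponentIn (f ⁻¹' V) x ∧ ∃ i, W ⊆ Q i}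
  have hopen : ∀ W ∈ 𝔚, IsOpen W := by
    rintro W ⟨V, hV, x, rfl, -⟩
    exact ((hB.isOpen hV).preimage hf).connectedComponentIn
  have hcov : ∀ x, ∃ W ∈ 𝔚, x ∈ W := by
    intro x
    obtain ⟨i, hi⟩ := hQ x
    obtain ⟨V, hVB, hxV, hV⟩ :=
      exists_connectedComponentIn_preimage_subset hf hinj hB ((hQo i).mem_nhds hi)
    exact ⟨_, ⟨V, hVB, x, rfl, i, hV⟩, mem_connectedComponentIn hxV⟩
  let r : Set X → Set X → Prop := fun W W' => W ∈ 𝔚 ∧ W' ∈ 𝔚 ∧ (W' ∩ W).Nonempty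
  have hr : ∀ W, {W' | r W W'}.Countable := by
    intro W
    by_cases hW : W ∈ 𝔚
    swap
    · convert countable_empty (α := Set X)
      exact eq_empty_of_forall_notMem fun W' h => hW h.1
    obtain ⟨-, -, -, -, i, hi⟩ := id hW
    have hsep : TopologicalSpace.IsSeparable W := (hQs i).mono hi
    -- For a fixed `V`, distinct components of `f ⁻¹' V` are disjoint, so the separable set `W`
    -- meets only countably many; there are countably many `V`.
    let A : Set Y → Set (Set X) := fun V =>
      {W' | W' ∈ 𝔚 ∧ (W' ∩ W).Nonempty ∧ ∃ x, W' = connectedComponentIn (f ⁻¹' V) x}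
    have hA : ∀ V ∈ B, (A V).Countable := by
      intro V _
      refine countable_of_pairwiseDisjoint_of_isSeparable hsep ?_ (fun s hs => hopen s hs.1)
        fun s hs => hs.2.1
      rintro s ⟨-, -, x, rfl⟩ s' ⟨-, -, x', rfl⟩ hne
      by_contra hd
      obtain ⟨z, hz, hz'⟩ := not_disjoint_iff.1 hd
      exact hne ((connectedComponentIn_eq hz).trans (connectedComponentIn_eq hz').symm)
    refine (hBc.biUnion hA).mono ?_
    rintro W' ⟨-, hW', hne⟩
    obtain ⟨V, hV, x, hx, -⟩ := id hW'
    exact mem_biUnion hV ⟨hW', hne, x, hx⟩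
  obtain ⟨W₀, hW₀, hpW₀⟩ := hcov p
  let S : Set (Set X) := {W | Relation.ReflTransGen r W₀ W}
  have hS : S.Countable := countable_setOf_reflTransGen hr W₀
  have hS𝔚 : ∀ W ∈ S, W ∈ 𝔚 := by
    intro W hW
    rcases Relation.ReflTransGen.cases_tail hW with h | ⟨_, _, h⟩
    · exact h ▸ hW₀
    · exact h.2.1
  -- A member of `𝔚` that meets a reachable one is reachable, so the complement is a union of
  -- members of `𝔚` as well.
  have hclopen : IsClopen (⋃₀ S) := by
    refine ⟨?_, isOpen_sUnion fun W hW => hopen W (hS𝔚 W hW)⟩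
    rw [← isOpen_compl_iff, isOpen_iff_forall_mem_open]
    intro x hx
    obtain ⟨W, hW, hxW⟩ := hcov x
    refine ⟨W, fun z hz hzS => hx ?_, hopen W hW, hxW⟩
    obtain ⟨W', hW', hzW'⟩ := hzS
    exact ⟨W, Relation.ReflTransGen.tail hW' ⟨hS𝔚 W' hW', hW, z, hz, hzW'⟩, hxW⟩
  have hsub : connectedComponent p ⊆ ⋃₀ S :=
    hclopen.connectedComponent_subset ⟨W₀, Relation.ReflTransGen.refl, hpW₀⟩
  have hi : ∀ W ∈ S, ∃ i, W ⊆ Q i := fun W hW => (hS𝔚 W hW).choose_spec.2.choose_spec.2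
  rcases isEmpty_or_nonempty ι with hι | hι
  · exact (hQ p).elim fun i _ => (hι.false i).elim
  choose! g hg using hi
  refine ⟨g '' S, hS.image g, hsub.trans ?_⟩
  rintro x ⟨W, hW, hx⟩
  exact mem_biUnion (mem_image_of_mem g hW) (hg W hW hx)

end PoincareVolterra

/-! ### Maps of constant rank and curves in their images -/

section ConstantRank

variable {H E : Type*} [NormedAddCommGroup H] [NormedSpace ℝ H]
  [NormedAddCommGroup E] [NormedSpace ℝ E]

/-- The constant rank theorem: near a point at which its rank is locally constant, a smooth map `f`
has a smooth generalized inverse `τ`. -/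
theorem exists_generalizedInverse_of_constant_rank [FiniteDimensional ℝ H]
    [FiniteDimensional ℝ E] {f : H → E} {h₀ : H} (hf : ContDiffAt ℝ ∞ f h₀)
    (hrank : ∀ᶠ h in 𝓝 h₀, Module.finrank ℝ (fderiv ℝ f h).ker =
      Module.finrank ℝ (fderiv ℝ f h₀).ker) {Ω : Set H} (hΩ : Ω ∈ 𝓝 h₀) :
    ∃ (W : Set H) (τ : E → H), IsOpen W ∧ h₀ ∈ W ∧ W ⊆ Ω ∧
      ∀ h ∈ W, DifferentiableAt ℝ τ (f h) ∧ τ (f h) ∈ Ω ∧ f (τ (f h)) = f h := by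
  have h1 : (∞ : WithTop ℕ∞) ≠ 0 := by simp
  set f' := fderiv ℝ f h₀ with hf'
  -- `P` projects onto the range of `f'`, and `π` onto `ker (P ∘ f') = ker f'`. With them `ψ = (P ∘
  -- f, π)` has an invertible derivative at `h₀`.
  obtain ⟨P, hP⟩ : f'.range.ClosedComplemented := Submodule.ClosedComplemented.of_finiteDimensional _
  obtain ⟨π, hπ⟩ : (P.comp f').ker.ClosedComplemented :=
    Submodule.ClosedComplemented.of_finiteDimensional _
  have hsurj : (P.comp f').range = ⊤ := by
    rw [LinearMap.range_eq_top]
    rintro ⟨_, x, rfl⟩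
    exact ⟨x, hP ⟨f' x, x, rfl⟩⟩
  have hsurj' : π.range = ⊤ := LinearMap.range_eq_top.2 fun x => ⟨x, hπ x⟩
  have hcompl : IsCompl (P.comp f').ker π.ker := LinearMap.isCompl_of_proj hπ
  let A := (P.comp f').equivProdOfSurjectiveOfIsCompl π hsurj hsurj' hcompl
  let ψ : H → f'.range × (P.comp f').ker := fun h => (P (f h), π h)
  have hψ : ContDiffAt ℝ ∞ ψ h₀ := (P.contDiff.contDiffAt.comp h₀ hf).prodMk π.contDiff.contDiffAt
  have hψ' : HasFDerivAt ψ (A : H →L[ℝ] f'.range × (P.comp f').ker) h₀ :=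
    (P.hasFDerivAt.comp h₀ (hf.differentiableAt h1).hasFDerivAt).prodMk π.hasFDerivAt
  obtain ⟨e, heψ, hh₀, hsymm⟩ : ∃ e : OpenPartialHomeomorph H (f'.range × (P.comp f').ker),
      (∀ h, e h = ψ h) ∧ h₀ ∈ e.source ∧ ContDiffAt ℝ ∞ e.symm (ψ h₀) :=
    ⟨hψ.toOpenPartialHomeomorph ψ hψ' h1, fun _ => rfl,
      hψ.mem_toOpenPartialHomeomorph_source hψ' h1, hψ.to_localInverse hψ' h1⟩
  have hsymm₀ : e.symm (ψ h₀) = h₀ := by rw [← heψ, e.left_inv hh₀]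
  have hsymm_tendsto : Tendsto e.symm (𝓝 (ψ h₀)) (𝓝 h₀) := by
    have := hsymm.continuousAt.tendsto
    rwa [hsymm₀] at this
  have hgood : ∀ᶠ y in 𝓝 (ψ h₀), y ∈ e.target ∧ DifferentiableAt ℝ e.symm y ∧ e.symm y ∈ Ω ∧
      DifferentiableAt ℝ f (e.symm y) ∧
      Module.finrank ℝ (fderiv ℝ f (e.symm y)).ker = Module.finrank ℝ f'.ker := by
    have hd : ∀ᶠ h in 𝓝 h₀, DifferentiableAt ℝ f h :=
      ((hf.of_le (m := 1) (by simp)).eventually (by simp)).mono fun _ h =>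
        h.differentiableAt (by simp)
    have hd' : ∀ᶠ y in 𝓝 (ψ h₀), DifferentiableAt ℝ e.symm y :=
      ((hsymm.of_le (m := 1) (by simp)).eventually (by simp)).mono fun _ h =>
        h.differentiableAt (by simp)
    filter_upwards [e.open_target.mem_nhds (heψ h₀ ▸ e.map_source hh₀), hd', hsymm_tendsto.eventually hΩ,
      hsymm_tendsto.eventually hd, hsymm_tendsto.eventually hrank] with y a b c d r
    exact ⟨a, b, c, d, r⟩
  obtain ⟨ε, hε, hball⟩ := Metric.eventually_nhds_iff_ball.1 hgood
  -- In the coordinates `ψ`, the map `f` depends on the first coordinate only.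
  have hconst : ∀ u w, (u, w) ∈ Metric.ball (ψ h₀) ε → f (e.symm (u, w)) = f (e.symm (u, π h₀)) := by
    intro u w huw
    rw [← ball_prod_same] at huw
    have hmem : ∀ w' ∈ Metric.ball (π h₀) ε, (u, w') ∈ Metric.ball (ψ h₀) ε := by
      intro w' hw'
      rw [← ball_prod_same]
      exact ⟨huw.1, hw'⟩
    have hder : ∀ w' ∈ Metric.ball (π h₀) ε,
        HasFDerivAt (fun w => f (e.symm (u, w))) (0 : (P.comp f').ker →L[ℝ] E) w' := by
      intro w' hw'
      obtain ⟨ht, hds, -, hdf, hr⟩ := hball _ (hmem w' hw')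
      set h := e.symm (u, w') with hh
      set D := fderiv ℝ e.symm (u, w')
      have hcomp := (hdf.hasFDerivAt.comp _ hds.hasFDerivAt)
      have hfst : P.comp ((fderiv ℝ f h).comp D) =
          ContinuousLinearMap.fst ℝ f'.range (P.comp f').ker := by
        refine (P.hasFDerivAt.comp (u, w') hcomp).unique (hasFDerivAt_fst.congr_of_eventuallyEq ?_)
        filter_upwards [e.open_target.mem_nhds ht] with y hy
        exact congrArg Prod.fst ((heψ _).symm.trans (e.right_inv hy))
      -- This is where constant rank enters: `P` maps the range of the derivative at `h` onto a
      -- space of the same dimension. The partial derivative in the second coordinate is killed by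
      -- `P`, so it vanishes.
      have hinj : Function.Injective (P.toLinearMap.comp (fderiv ℝ f h).range.subtype) := by
        refine (LinearMap.injective_iff_surjective_of_finrank_eq_finrank ?_).2 ?_
        · have e1 := (fderiv ℝ f h).toLinearMap.finrank_range_add_finrank_ker
          have e2 := f'.toLinearMap.finrank_range_add_finrank_ker
          omega
        · intro v
          exact ⟨⟨fderiv ℝ f h (D (v, 0)), _, rfl⟩, DFunLike.congr_fun hfst (v, 0)⟩
      have hz : ((fderiv ℝ f h).comp D).comp (ContinuousLinearMap.inr ℝ f'.range (P.comp f').ker)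
          = 0 := by
        ext w''
        have : (⟨fderiv ℝ f h (D (0, w'')), _, rfl⟩ : (fderiv ℝ f h).range) = 0 := by
          apply hinj
          rw [map_zero]
          exact DFunLike.congr_fun hfst (0, w'')
        exact congrArg Subtype.val this
      rw [← hz]
      exact hcomp.comp w' (hasFDerivAt_prodMk_right u w')
    exact Metric.isOpen_ball.is_const_of_fderiv_eq_zero (𝕜 := ℝ)
      (convex_ball (π h₀) ε).isPreconnected
      (fun w' hw' => (hder w' hw').differentiableAt.differentiableWithinAt)
      (fun w' hw' => (hder w' hw').fderiv) huw.2 (Metric.mem_ball_self hε)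
  -- The generalized inverse freezes the second coordinate at `π h₀`, which by `hconst` does not
  -- change the value of `f`.
  refine ⟨e.source ∩ e ⁻¹' Metric.ball (ψ h₀) ε, fun z => e.symm (P z, π h₀),
    e.isOpen_inter_preimage Metric.isOpen_ball, ⟨hh₀, mem_preimage.2 (heψ h₀ ▸ Metric.mem_ball_self hε)⟩,
    ?_, ?_⟩
  · rintro h ⟨hs, hb⟩
    have := (hball _ hb).2.2.1
    rwa [e.left_inv hs] at this
  · rintro h ⟨hs, hb⟩
    replace hb : (P (f h), π h) ∈ Metric.ball (ψ h₀) ε := by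
      have hb : e h ∈ Metric.ball (ψ h₀) ε := hb
      rwa [heψ] at hb
    have hb' : (P (f h), π h₀) ∈ Metric.ball (ψ h₀) ε := by
      rw [← ball_prod_same] at hb ⊢
      exact ⟨hb.1, Metric.mem_ball_self hε⟩
    obtain ⟨-, hd, hΩ', -, -⟩ := hball _ hb'
    refine ⟨?_, hΩ', ?_⟩
    · exact DifferentiableAt.comp (f h) (g := e.symm) (f := fun z => (P z, π h₀)) hd
        (P.differentiableAt.prodMk (differentiableAt_const _))
    · rw [← hconst (P (f h)) (π h) hb]
      exact congrArg f ((congrArg e.symm (heψ h).symm).trans (e.left_inv hs))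

/-- If two maps that agree on the set `C` are differentiable at an accumulation point of `C`, then
their derivatives agree at this point. -/
theorem deriv_eq_of_accPt {a b : ℝ → E} {C : Set ℝ} {s : ℝ} (hab : EqOn a b C) (hs : s ∈ C)
    (hacc : AccPt s (𝓟 C)) {a' b' : E} (ha : HasDerivAt a a' s) (hb : HasDerivAt b b' s) :
    a' = b' :=
  (uniqueDiffWithinAt_iff_accPt.2 hacc).eq_deriv C
    (ha.hasDerivWithinAt.congr_of_mem (fun _ h => (hab h).symm) hs) hb.hasDerivWithinAt

/-- If countably many sets of real numbers cover the real line, then the points that are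
accumulation points of one of the sets that contain them are dense. -/
theorem dense_setOf_accPt {ι : Type*} {c : Set ι} (hc : c.Countable) {C : ι → Set ℝ}
    (hC : ∀ s, ∃ i ∈ c, s ∈ C i) : Dense {s | ∃ i ∈ c, s ∈ C i ∧ AccPt s (𝓟 (C i))} := by
  -- Every set of reals has only countably many points that are isolated in it from the right.
  have hcount : (⋃ i ∈ c, {x ∈ C i | 𝓝[C i ∩ Ioi x] x = ⊥}).Countable :=
    hc.biUnion fun i _ => countable_setOfPred_isolated_right_within
  refine (hcount.dense_compl ℝ).mono fun s hs => ?_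
  obtain ⟨i, hi, hsi⟩ := hC s
  refine ⟨i, hi, hsi, ?_⟩
  rw [accPt_principal_iff_nhdsWithin]
  have h : 𝓝[C i ∩ Ioi s] s ≠ ⊥ := fun h => hs (mem_biUnion hi ⟨hsi, h⟩)
  exact (neBot_iff.2 h).mono (nhdsWithin_mono s fun x hx => ⟨hx.1, (ne_of_gt hx.2)⟩)

end ConstantRank

/-! ### Forms in charts and naturality of the exterior derivative -/

section FormsInCharts

variable {E : Type*} [NormedAddCommGroup E] [NormedSpace ℝ E]
  {M : Type*} [TopologicalSpace M] [ChartedSpace E M]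
  {E' : Type*} [NormedAddCommGroup E'] [NormedSpace ℝ E']
  {N : Type*} [TopologicalSpace N] [ChartedSpace E' N]
  {k : ℕ}

/-- The derivative of a map between manifolds, as a map between the model spaces. -/
def D (E' : Type*) [NormedAddCommGroup E'] [NormedSpace ℝ E'] (E : Type*) [NormedAddCommGroup E]
    [NormedSpace ℝ E] {N : Type*} [TopologicalSpace N] [ChartedSpace E' N]
    {M : Type*} [TopologicalSpace M] [ChartedSpace E M] (f : N → M) (x : N) : E' →L[ℝ] E :=
  mfderiv 𝓘(ℝ, E') 𝓘(ℝ, E) f x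

theorem D_eq_fderiv (f : E' → E) (x : E') : D E' E f x = fderiv ℝ f x := mfderiv_eq_fderiv

theorem D_id (x : M) : D E E (fun x : M => x) x = ContinuousLinearMap.id ℝ E := mfderiv_id

/-- The base point `y` is kept separate from `f x`, so that identities such as `src (unit x) = x`
cause no dependent rewriting. -/
theorem D_comp {E'' : Type*} [NormedAddCommGroup E''] [NormedSpace ℝ E'']
    {P : Type*} [TopologicalSpace P] [ChartedSpace E'' P] {g : M → P} {f : N → M} {x : N} {y : M}
    (hg : MDifferentiableAt 𝓘(ℝ, E) 𝓘(ℝ, E'') g y) (hf : MDifferentiableAt 𝓘(ℝ, E') 𝓘(ℝ, E) f x)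
    (hxy : f x = y) : D E' E'' (fun z => g (f z)) x = (D E E'' g y).comp (D E' E f x) := by
  subst hxy
  exact mfderiv_comp x hg hf

/-- The value of a form on vectors, all of which are regarded as elements of the model space. -/
def Form.eval (α : Form E M k) (x : M) : E [⋀^Fin k]→L[ℝ] ℝ := α x

theorem Form.pullback_eval (f : N → M) (α : Form E M k) (x : N) :
    (Form.pullback f α).eval x = (α.eval (f x)).compContinuousLinearMap (D E' E f x) := rfl

theorem Form.inChart_eq (α : Form E M k) (e : OpenPartialHomeomorph M E) (y : E) :
    α.inChart e y = (α.eval (e.symm y)).compContinuousLinearMap (D E E e.symm y) := rfl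

theorem Form.d_eval (α : Form E M k) (x : M) :
    α.d.eval x = (extDeriv (α.inChart (chartAt E x)) (chartAt E x x)).compContinuousLinearMap
      (D E E (chartAt E x) x) := rfl

section

variable {e : OpenPartialHomeomorph M E} (he : e ∈ IsManifold.maximalAtlas 𝓘(ℝ, E) ∞ M)
include he

theorem mdifferentiable_of_mem_maximalAtlas : e.MDifferentiable 𝓘(ℝ, E) 𝓘(ℝ, E) :=
  ⟨(contMDiffOn_of_mem_maximalAtlas he).mdifferentiableOn (by simp),
    (contMDiffOn_symm_of_mem_maximalAtlas he).mdifferentiableOn (by simp)⟩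

theorem D_symm_D {x : M} (hx : x ∈ e.source) (v : E) : D E E e.symm (e x) (D E E e x v) = v :=
  DFunLike.congr_fun ((mdifferentiable_of_mem_maximalAtlas he).symm_comp_deriv hx) v

theorem D_D_symm {y : E} (hy : y ∈ e.target) (v : E) :
    D E E e (e.symm y) (D E E e.symm y v) = v :=
  DFunLike.congr_fun ((mdifferentiable_of_mem_maximalAtlas he).comp_symm_deriv hy) v

theorem Form.eq_of_inChart_eq {α β : Form E M k} {x : M} (hx : x ∈ e.source)
    (h : α.inChart e (e x) = β.inChart e (e x)) : α x = β x := by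
  change α.eval x = β.eval x
  ext v
  have := DFunLike.congr_fun h fun i => D E E e x (v i)
  rw [Form.inChart_eq, Form.inChart_eq, e.left_inv hx] at this
  simpa [Function.comp_def, D_symm_D he hx] using this

end

/-- A map between manifolds, written in charts. -/
abbrev writtenIn (ψ : OpenPartialHomeomorph N E') (e : OpenPartialHomeomorph M E) (f : N → M) :
    E' → E := fun y => e (f (ψ.symm y))

section

variable {ψ : OpenPartialHomeomorph N E'} (hψ : ψ ∈ IsManifold.maximalAtlas 𝓘(ℝ, E') ∞ N)
  {e : OpenPartialHomeomorph M E} (he : e ∈ IsManifold.maximalAtlas 𝓘(ℝ, E) ∞ M)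
  {f : N → M} (hf : ContMDiff 𝓘(ℝ, E') 𝓘(ℝ, E) ∞ f)
include hψ he hf

theorem contDiffAt_writtenIn {y : E'} (hy : y ∈ ψ.target) (hfy : f (ψ.symm y) ∈ e.source) :
    ContDiffAt ℝ ∞ (writtenIn ψ e f) y :=
  ((contMDiffAt_of_mem_maximalAtlas he hfy).comp y
    (hf.contMDiffAt.comp y (contMDiffAt_symm_of_mem_maximalAtlas hψ hy))).contDiffAt

theorem fderiv_writtenIn {y : E'} (hy : y ∈ ψ.target) (hfy : f (ψ.symm y) ∈ e.source) :
    fderiv ℝ (writtenIn ψ e f) y =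
      (D E E e (f (ψ.symm y))).comp ((D E' E f (ψ.symm y)).comp (D E' E' ψ.symm y)) := by
  have hd := hf.mdifferentiable (by simp)
  have hψ' := (mdifferentiable_of_mem_maximalAtlas hψ).mdifferentiableAt_symm hy
  rw [← D_eq_fderiv, ← D_comp (hd _) hψ' rfl]
  exact D_comp ((mdifferentiable_of_mem_maximalAtlas he).mdifferentiableAt hfy)
    ((hd _).comp y hψ') rfl

/-- The coordinate expression of a pullback is the pullback of the coordinate expression. -/
theorem Form.pullback_inChart (α : Form E M k) {y : E'} (hy : y ∈ ψ.target)
    (hfy : f (ψ.symm y) ∈ e.source) :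
    (Form.pullback f α).inChart ψ y =
      (α.inChart e (writtenIn ψ e f y)).compContinuousLinearMap
        (fderiv ℝ (writtenIn ψ e f) y) := by
  rw [Form.inChart_eq, Form.inChart_eq, Form.pullback_eval, e.left_inv hfy,
    fderiv_writtenIn hψ he hf hy hfy]
  ext v
  simp [Function.comp_def, D_symm_D he hfy]

end

theorem Form.pullback_id (α : Form E M k) : Form.pullback (fun x => x) α = α := by
  funext x
  change (Form.pullback (fun x => x) α).eval x = α.eval x
  rw [Form.pullback_eval, D_id]
  rfl

theorem Form.IsSmooth.differentiableAt_inChart {α : Form E M k} (hα : α.IsSmooth)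
    {e : OpenPartialHomeomorph M E} (he : e ∈ atlas E M) {y : E} (hy : y ∈ e.target) :
    DifferentiableAt ℝ (α.inChart e) y :=
  ((hα e he).contDiffAt (e.open_target.mem_nhds hy)).differentiableAt (by simp)

variable [IsManifold 𝓘(ℝ, E) ∞ M]

variable {ψ : OpenPartialHomeomorph N E'} (hψ : ψ ∈ IsManifold.maximalAtlas 𝓘(ℝ, E') ∞ N)
  {f : N → M} (hf : ContMDiff 𝓘(ℝ, E') 𝓘(ℝ, E) ∞ f)
include hψ hf

theorem Form.pullback_inChart_eventuallyEq (α : Form E M k) {e : OpenPartialHomeomorph M E}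
    (he : e ∈ atlas E M) {y : E'} (hy : y ∈ ψ.target) (hfy : f (ψ.symm y) ∈ e.source) :
    (Form.pullback f α).inChart ψ =ᶠ[𝓝 y] fun z =>
      (α.inChart e (writtenIn ψ e f z)).compContinuousLinearMap
        (fderiv ℝ (writtenIn ψ e f) z) := by
  have hc : ContinuousAt (fun z => f (ψ.symm z)) y :=
    hf.continuous.continuousAt.comp (ψ.symm.continuousAt hy)
  filter_upwards [ψ.open_target.mem_nhds hy, hc.preimage_mem_nhds (e.open_source.mem_nhds hfy)]
    with z hz hfz
  exact Form.pullback_inChart hψ (IsManifold.subset_maximalAtlas he) hf α hz hfz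

theorem Form.IsSmooth.differentiableAt_pullback_inChart {α : Form E M k} (hα : α.IsSmooth) {y : E'}
    (hy : y ∈ ψ.target) : DifferentiableAt ℝ ((Form.pullback f α).inChart ψ) y := by
  have he := chart_mem_atlas E (f (ψ.symm y))
  have hfy := mem_chart_source E (f (ψ.symm y))
  refine DifferentiableAt.congr_of_eventuallyEq ?_
    (Form.pullback_inChart_eventuallyEq hψ hf α he hy hfy)
  have hw := contDiffAt_writtenIn hψ (IsManifold.subset_maximalAtlas he) hf hy hfy
  refine DifferentiableAt.continuousAlternatingMapCompContinuousLinearMap ?_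
    ((hw.fderiv_right (m := 1) (WithTop.coe_le_coe.2 le_top)).differentiableAt (by simp))
  exact (hα.differentiableAt_inChart he ((chartAt E (f (ψ.symm y))).map_source hfy)).comp y
    (hw.differentiableAt (by simp))

theorem Form.extDeriv_pullback_inChart {α : Form E M k} (hα : α.IsSmooth)
    {e : OpenPartialHomeomorph M E} (he : e ∈ atlas E M) {y : E'} (hy : y ∈ ψ.target)
    (hfy : f (ψ.symm y) ∈ e.source) :
    extDeriv ((Form.pullback f α).inChart ψ) y =
      (extDeriv (α.inChart e) (writtenIn ψ e f y)).compContinuousLinearMap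
        (fderiv ℝ (writtenIn ψ e f) y) := by
  rw [(Form.pullback_inChart_eventuallyEq hψ hf α he hy hfy).extDeriv_eq]
  refine extDeriv_pullback (r := ∞) (hα.differentiableAt_inChart he (e.map_source hfy))
    (contDiffAt_writtenIn hψ (IsManifold.subset_maximalAtlas he) hf hy hfy) ?_
  rw [minSmoothness_of_isRCLikeNormedField]
  exact WithTop.coe_le_coe.2 le_top

/-- The exterior derivative commutes with pullbacks. -/
theorem Form.pullback_d_inChart {α : Form E M k} (hα : α.IsSmooth) {y : E'} (hy : y ∈ ψ.target) :
    (Form.pullback f α.d).inChart ψ y = extDeriv ((Form.pullback f α).inChart ψ) y := by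
  -- The preferred chart at the image point is the one in which `Form.d` is defined there.
  have he := chart_mem_atlas E (f (ψ.symm y))
  have hfy := mem_chart_source E (f (ψ.symm y))
  rw [Form.extDeriv_pullback_inChart hψ hf hα he hy hfy]
  rw [Form.inChart_eq, Form.pullback_eval, Form.d_eval,
    fderiv_writtenIn hψ (IsManifold.subset_maximalAtlas he) hf hy hfy]
  rfl

omit hψ hf

/-- Naturality under the identity map, with `e` in place of `ψ`, amounts to independence of the
chart. -/
theorem Form.d_inChart {α : Form E M k} (hα : α.IsSmooth) {e : OpenPartialHomeomorph M E}
    (he : e ∈ atlas E M) {y : E} (hy : y ∈ e.target) :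
    α.d.inChart e y = extDeriv (α.inChart e) y := by
  have := Form.pullback_d_inChart (f := fun x => x) (IsManifold.subset_maximalAtlas he)
    contMDiff_id hα hy
  rwa [Form.pullback_id, Form.pullback_id] at this

theorem Form.IsSmooth.continuousOn_d_inChart {α : Form E M k} (hα : α.IsSmooth)
    {e : OpenPartialHomeomorph M E} (he : e ∈ atlas E M) :
    ContinuousOn (α.d.inChart e) e.target := by
  have h : ContinuousOn (fderiv ℝ (α.inChart e)) e.target :=
    (hα e he).continuousOn_fderiv_of_isOpen e.open_target (by simp)
  refine ((ContinuousAlternatingMap.alternatizeUncurryFinCLM ℝ E ℝ).continuous.comp_continuousOn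
    h).congr fun y hy => ?_
  exact Form.d_inChart hα he hy

end FormsInCharts

/-! ### Fibers of submersions -/

section Submersions

variable {E : Type*} [NormedAddCommGroup E] [NormedSpace ℝ E]
  {M : Type*} [TopologicalSpace M] [ChartedSpace E M]
  {E' : Type*} [NormedAddCommGroup E'] [NormedSpace ℝ E']
  {N : Type*} [TopologicalSpace N] [ChartedSpace E' N]

/-- Charts around `g` and `s g` in which `s` is a linear projection. -/
structure SubmersionChart (E : Type*) [NormedAddCommGroup E] [NormedSpace ℝ E]
    {M : Type*} [TopologicalSpace M] [ChartedSpace E M]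
    (E' : Type*) [NormedAddCommGroup E'] [NormedSpace ℝ E']
    {N : Type*} [TopologicalSpace N] [ChartedSpace E' N] (s : N → M) (g : N) where
  /-- the chart of the domain -/
  dom : OpenPartialHomeomorph N E'
  /-- the chart of the codomain -/
  cod : OpenPartialHomeomorph M E
  /-- the projection -/
  proj : E' →L[ℝ] E
  dom_mem : dom ∈ IsManifold.maximalAtlas 𝓘(ℝ, E') ∞ N
  cod_mem : cod ∈ IsManifold.maximalAtlas 𝓘(ℝ, E) ∞ M
  proj_surjective : Function.Surjective proj
  mem_source : g ∈ dom.source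
  mapsTo : MapsTo s dom.source cod.source
  cod_map : ∀ y ∈ dom.target, cod (s (dom.symm y)) = proj y

theorem nonempty_submersionChart {s : N → M}
    (hs : Manifold.IsSubmersion 𝓘(ℝ, E') 𝓘(ℝ, E) ∞ s) (g : N) :
    Nonempty (SubmersionChart E E' s g) := by
  have h := hs.isSubmersionAt g
  exact ⟨{
    dom := h.domChart
    cod := h.codChart
    proj := (ContinuousLinearMap.fst ℝ E _).comp (h.equiv : E' →L[ℝ] E × h.complement)
    dom_mem := h.domChart_mem_maximalAtlas
    cod_mem := h.codChart_mem_maximalAtlas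
    proj_surjective := fun u => ⟨h.equiv.symm (u, 0), by simp⟩
    mem_source := h.mem_domChart_source
    mapsTo := h.source_subset_preimage_source
    cod_map := fun y hy => by
      have := h.writtenInCharts
        (show y ∈ (h.domChart.extend 𝓘(ℝ, E')).target by simpa using hy)
      simpa using this }⟩

namespace SubmersionChart

variable {s : N → M} {g : N} (C : SubmersionChart E E' s g)

/-- The parametrization of the fiber through `g` by the kernel of the projection. -/
def fiberMap (w : C.proj.ker) : N := C.dom.symm (C.dom g + w)

/-- The domain of the parametrization of the fiber through `g`. -/
def fiberDomain : Set C.proj.ker := {w | C.dom g + w ∈ C.dom.target}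

theorem isOpen_fiberDomain : IsOpen C.fiberDomain :=
  C.dom.open_target.preimage (by fun_prop)

theorem zero_mem_fiberDomain : 0 ∈ C.fiberDomain := by
  simpa [fiberDomain] using C.dom.map_source C.mem_source

@[simp] theorem fiberMap_zero : C.fiberMap 0 = g := by
  simpa [fiberMap] using C.dom.left_inv C.mem_source

theorem fiberMap_mem_source {w : C.proj.ker} (hw : w ∈ C.fiberDomain) :
    C.fiberMap w ∈ C.dom.source := C.dom.map_target hw

theorem eq_of_mem_source {h h' : N} (hh : h ∈ C.dom.source) (hh' : h' ∈ C.dom.source) :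
    s h = s h' ↔ C.proj (C.dom h) = C.proj (C.dom h') := by
  rw [← C.cod_map _ (C.dom.map_source hh), ← C.cod_map _ (C.dom.map_source hh'),
    C.dom.left_inv hh, C.dom.left_inv hh']
  exact (C.cod.injOn.eq_iff (C.mapsTo hh) (C.mapsTo hh')).symm

theorem map_fiberMap {w : C.proj.ker} (hw : w ∈ C.fiberDomain) : s (C.fiberMap w) = s g := by
  rw [C.eq_of_mem_source (C.fiberMap_mem_source hw) C.mem_source, fiberMap, C.dom.right_inv hw,
    map_add]
  simp

theorem contMDiffOn_fiberMap : ContMDiffOn 𝓘(ℝ, C.proj.ker) 𝓘(ℝ, E') ∞ C.fiberMap C.fiberDomain :=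
  (contMDiffOn_symm_of_mem_maximalAtlas C.dom_mem).comp
    (s := C.fiberDomain) (f := fun w : C.proj.ker => C.dom g + (w : E'))
    (contDiff_const.add C.proj.ker.subtypeL.contDiff).contMDiff.contMDiffOn fun _ hw => hw

theorem D_fiberMap {w : C.proj.ker} (hw : w ∈ C.fiberDomain) :
    D C.proj.ker E' C.fiberMap w =
      (D E' E' C.dom.symm (C.dom g + w)).comp C.proj.ker.subtypeL := by
  have h : HasFDerivAt (fun w : C.proj.ker => C.dom g + (w : E')) C.proj.ker.subtypeL w :=
    C.proj.ker.subtypeL.hasFDerivAt.const_add _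
  have h2 := D_comp (E := E') (E' := C.proj.ker) (E'' := E')
    (f := fun w : C.proj.ker => C.dom g + (w : E')) (x := w)
    ((mdifferentiable_of_mem_maximalAtlas C.dom_mem).mdifferentiableAt_symm hw)
    h.differentiableAt.mdifferentiableAt rfl
  rw [D_eq_fderiv, h.fderiv] at h2
  exact h2

/-- A vector is tangent to the fiber if its coordinate expression lies in the kernel of the
projection. -/
theorem D_symm_eq_zero_iff (hs : ContMDiff 𝓘(ℝ, E') 𝓘(ℝ, E) ∞ s) {y : E'} (hy : y ∈ C.dom.target)
    (v : E') : D E' E s (C.dom.symm y) (D E' E' C.dom.symm y v) = 0 ↔ C.proj v = 0 := by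
  have hsy := C.mapsTo (C.dom.map_target hy)
  have h : fderiv ℝ (writtenIn C.dom C.cod s) y = C.proj := by
    refine ((C.proj.hasFDerivAt (x := y)).congr_of_eventuallyEq ?_).fderiv
    filter_upwards [C.dom.open_target.mem_nhds hy] with z hz using C.cod_map z hz
  rw [fderiv_writtenIn C.dom_mem C.cod_mem hs hy hsy] at h
  rw [← h]
  simp only [ContinuousLinearMap.comp_apply]
  refine ⟨fun h => by rw [h, map_zero], fun h => ?_⟩
  rw [← D_symm_D C.cod_mem hsy (D E' E s _ _), h, map_zero]

theorem range_D_fiberMap (hs : ContMDiff 𝓘(ℝ, E') 𝓘(ℝ, E) ∞ s) {w : C.proj.ker}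
    (hw : w ∈ C.fiberDomain) :
    (D C.proj.ker E' C.fiberMap w).range = (D E' E s (C.fiberMap w)).ker := by
  rw [C.D_fiberMap hw]
  ext a
  constructor
  · rintro ⟨v, rfl⟩
    exact (C.D_symm_eq_zero_iff hs hw v).2 v.2
  · intro ha
    have ha' : D E' E s (C.dom.symm (C.dom g + w)) a = 0 := ha
    have h := D_symm_D C.dom_mem (C.fiberMap_mem_source hw) a
    rw [fiberMap, C.dom.right_inv hw] at h
    rw [← h, C.D_symm_eq_zero_iff hs hw] at ha'
    exact ⟨⟨_, ha'⟩, h⟩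

theorem injective_D_fiberMap {w : C.proj.ker} (hw : w ∈ C.fiberDomain) :
    Function.Injective (D C.proj.ker E' C.fiberMap w) := by
  rw [C.D_fiberMap hw]
  intro v v' h
  have := congrArg (D E' E' C.dom (C.dom.symm (C.dom g + w))) h
  simp only [ContinuousLinearMap.comp_apply, D_D_symm C.dom_mem hw] at this
  exact Subtype.ext this

/-- The parametrization of a fiber is open. -/
theorem exists_isOpen_inter_fiber {W : Set C.proj.ker} (hW : IsOpen W) (hWD : W ⊆ C.fiberDomain) :
    ∃ U : Set N, IsOpen U ∧ U ∩ s ⁻¹' {s g} = C.fiberMap '' W := by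
  obtain ⟨W', hW', rfl⟩ := isOpen_induced_iff.1 hW
  refine ⟨C.dom.source ∩ C.dom ⁻¹' ((fun y => y - C.dom g) ⁻¹' W'),
    C.dom.isOpen_inter_preimage (hW'.preimage (by fun_prop)), ?_⟩
  ext h
  constructor
  · rintro ⟨⟨hh, hhW⟩, hs⟩
    have hk : C.dom h - C.dom g ∈ C.proj.ker := by
      rw [LinearMap.mem_ker]
      simpa [sub_eq_zero] using (C.eq_of_mem_source hh C.mem_source).1 hs
    refine ⟨⟨_, hk⟩, hhW, ?_⟩
    simpa [fiberMap] using C.dom.left_inv hh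
  · rintro ⟨w, hw, rfl⟩
    refine ⟨⟨C.fiberMap_mem_source (hWD hw), ?_⟩, C.map_fiberMap (hWD hw)⟩
    have : C.dom (C.fiberMap w) = C.dom g + w := C.dom.right_inv (hWD hw)
    simpa [this] using hw

end SubmersionChart

/-- Each vector that is tangent to a fiber is the velocity of a smooth curve in the fiber. -/
theorem exists_curve_in_fiber {s : N → M} (hs : Manifold.IsSubmersion 𝓘(ℝ, E') 𝓘(ℝ, E) ∞ s) {g : N}
    {a : E'} (ha : D E' E s g a = 0) :
    ∃ c : ℝ → N, ContMDiff 𝓘(ℝ, ℝ) 𝓘(ℝ, E') ∞ c ∧ c 0 = g ∧ (∀ τ, s (c τ) = s g) ∧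
      D ℝ E' c 0 1 = a := by
  obtain ⟨C⟩ := nonempty_submersionChart hs g
  have hr := C.range_D_fiberMap hs.contMDiff C.zero_mem_fiberDomain
  rw [C.fiberMap_zero] at hr
  obtain ⟨w, hw⟩ : a ∈ (D C.proj.ker E' C.fiberMap 0).range := hr ▸ ha
  obtain ⟨ε, hε, hball⟩ := Metric.isOpen_iff.1 C.isOpen_fiberDomain 0 C.zero_mem_fiberDomain
  obtain ⟨δ, hδ, hδε⟩ : ∃ δ > 0, δ * ‖w‖ < ε := by
    refine ⟨ε / (‖w‖ + 1), by positivity, ?_⟩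
    rw [div_mul_eq_mul_div, div_lt_iff₀ (by positivity)]
    nlinarith [norm_nonneg w]
  -- The curve must be defined for all times, but the parametrization only near 0. The sine keeps
  -- `b` in the ball of radius `ε`, and the factors `δ` cancel in its velocity at 0.
  let b : ℝ → C.proj.ker := fun τ => (δ * Real.sin (τ / δ)) • w
  have hb : ContDiff ℝ ∞ b :=
    (contDiff_const.mul (Real.contDiff_sin.comp (contDiff_id.div_const δ))).smul contDiff_const
  have hbD : ∀ τ, b τ ∈ C.fiberDomain := by
    intro τ
    apply hball
    rw [mem_ball_zero_iff, norm_smul, norm_mul, Real.norm_of_nonneg hδ.le]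
    refine lt_of_le_of_lt ?_ hδε
    gcongr
    exact mul_le_of_le_one_right hδ.le (Real.abs_sin_le_one _)
  have hb0 : b 0 = 0 := by simp [b]
  have hb' : HasDerivAt b w 0 := by
    have h1 : HasDerivAt (fun τ : ℝ => δ * Real.sin (τ / δ)) 1 0 := by
      have := (((hasDerivAt_id (0 : ℝ)).div_const δ).sin).const_mul δ
      simpa [hδ.ne'] using this
    simpa using h1.smul_const w
  refine ⟨fun τ => C.fiberMap (b τ), ?_, by simp [hb0], fun τ => C.map_fiberMap (hbD τ), ?_⟩
  · exact C.contMDiffOn_fiberMap.comp_contMDiff hb.contMDiff hbD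
  · have h := D_comp (E := C.proj.ker) (E' := ℝ) (E'' := E') (g := C.fiberMap) (f := b) (x := 0)
      (y := 0) ((C.contMDiffOn_fiberMap.contMDiffAt
        (C.isOpen_fiberDomain.mem_nhds C.zero_mem_fiberDomain)).mdifferentiableAt (by simp))
      (hb.contMDiff.mdifferentiable (by simp) 0) hb0
    rw [h, D_eq_fderiv, ContinuousLinearMap.comp_apply, hb'.hasFDerivAt.fderiv]
    simpa using hw

/-- The fibers of submersions are locally connected. -/
theorem locallyConnectedSpace_fiber {s : N → M}
    (hs : Manifold.IsSubmersion 𝓘(ℝ, E') 𝓘(ℝ, E) ∞ s) (x : M) :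
    LocallyConnectedSpace (s ⁻¹' {x}) := by
  rw [locallyConnectedSpace_iff_connected_subsets]
  rintro ⟨g, rfl⟩ U hU
  obtain ⟨C⟩ := nonempty_submersionChart hs g
  let θ : C.fiberDomain → s ⁻¹' {s g} := fun w => ⟨C.fiberMap w, C.map_fiberMap w.2⟩
  have hθ : Continuous θ :=
    C.contMDiffOn_fiberMap.continuousOn.domRestrict.subtype_mk _
  have h0 : θ ⟨0, C.zero_mem_fiberDomain⟩ = ⟨g, rfl⟩ := Subtype.ext C.fiberMap_zero
  have hn : θ ⁻¹' U ∈ 𝓝 ⟨0, C.zero_mem_fiberDomain⟩ := hθ.continuousAt.preimage_mem_nhds (h0 ▸ hU)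
  rw [mem_nhds_subtype] at hn
  obtain ⟨V, hV, hVU⟩ := hn
  obtain ⟨ε, hε, hball⟩ := Metric.mem_nhds_iff.1
    (inter_mem hV (C.isOpen_fiberDomain.mem_nhds C.zero_mem_fiberDomain))
  have hbD : Metric.ball (0 : C.proj.ker) ε ⊆ C.fiberDomain := fun w hw => (hball hw).2
  obtain ⟨O, hO, hOs⟩ := C.exists_isOpen_inter_fiber Metric.isOpen_ball hbD
  have himage : Subtype.val '' (Subtype.val ⁻¹' O : Set (s ⁻¹' {s g})) =
      C.fiberMap '' Metric.ball 0 ε := by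
    rw [Subtype.image_preimage_coe, inter_comm, hOs]
  refine ⟨Subtype.val ⁻¹' O, (hO.preimage continuous_subtype_val).mem_nhds ?_, ?_, ?_⟩
  · have : g ∈ O ∩ s ⁻¹' {s g} := hOs ▸ ⟨0, Metric.mem_ball_self hε, C.fiberMap_zero⟩
    exact this.1
  · rw [← Topology.IsInducing.subtypeVal.isPreconnected_image, himage]
    exact (convex_ball _ _).isPreconnected.image _
      (C.contMDiffOn_fiberMap.continuousOn.mono hbD)
  · rintro h hh
    have : (h : N) ∈ C.fiberMap '' Metric.ball 0 ε := himage ▸ mem_image_of_mem _ hh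
    obtain ⟨w, hw, hwh⟩ := this
    have : θ ⟨w, hbD hw⟩ = h := Subtype.ext hwh
    rw [← this]
    exact hVU (hball hw).1

end Submersions

namespace LieGroupoid

/-! ### Translations in Lie groupoids -/

section Translations

variable {E : Type*} [NormedAddCommGroup E] [NormedSpace ℝ E]
  {E' : Type*} [NormedAddCommGroup E'] [NormedSpace ℝ E']
  {M : Type*} [TopologicalSpace M] [ChartedSpace E M]
  {G : Type*} [TopologicalSpace G] [ChartedSpace E' G]
  (𝒢 : LieGroupoid E E' M G)

theorem smooth_src : ContMDiff 𝓘(ℝ, E') 𝓘(ℝ, E) ∞ 𝒢.src := 𝒢.submersion_src.contMDiff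

theorem inv_inv (g : G) : 𝒢.inv (𝒢.inv g) = g := by
  have h := 𝒢.mul_assoc (𝒢.inv (𝒢.inv g)) (𝒢.inv g) g (by rw [𝒢.src_inv]) (𝒢.src_inv g)
  rw [𝒢.inv_mul, 𝒢.inv_mul, 𝒢.src_inv, 𝒢.unit_mul] at h
  have h' := 𝒢.mul_unit (𝒢.inv (𝒢.inv g))
  rw [𝒢.src_inv, 𝒢.tgt_inv] at h'
  exact h'.symm.trans h.symm

theorem mul_mul_inv {g k : G} (h : 𝒢.src g = 𝒢.tgt k) : 𝒢.mul (𝒢.mul g k) (𝒢.inv k) = g := by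
  rw [𝒢.mul_assoc g k _ h (𝒢.tgt_inv k).symm, 𝒢.mul_inv, ← h, 𝒢.mul_unit]

theorem inv_mul_mul {g k : G} (h : 𝒢.src g = 𝒢.tgt k) : 𝒢.mul (𝒢.inv g) (𝒢.mul g k) = k := by
  rw [← 𝒢.mul_assoc _ g k (𝒢.src_inv g) h, 𝒢.inv_mul, h, 𝒢.unit_mul]

theorem contMDiffOn_mul_right (k : G) :
    ContMDiffOn 𝓘(ℝ, E') 𝓘(ℝ, E') ∞ (fun h => 𝒢.mul h k) {h | 𝒢.src h = 𝒢.tgt k} :=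
  𝒢.smooth_mul.comp (s := {h | 𝒢.src h = 𝒢.tgt k}) (f := fun h => (h, k))
    (contMDiff_id.prodMk contMDiff_const).contMDiffOn fun _ h => h

/-- Right multiplication by `k` makes sense only on a source fiber, in general not a set of unique
differentiability. So `R` is some derivative within the fiber, and only its effect on curves in the
fiber is recorded. -/
theorem exists_deriv_mul_right (g k : G) (hgk : 𝒢.src g = 𝒢.tgt k) :
    ∃ R : E' →L[ℝ] E', ∀ c : ℝ → G, ContMDiff 𝓘(ℝ, ℝ) 𝓘(ℝ, E') ∞ c → c 0 = g →
      (∀ τ, 𝒢.src (c τ) = 𝒢.tgt k) →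
      D ℝ E' (fun τ => 𝒢.mul (c τ) k) 0 = R.comp (D ℝ E' c 0) := by
  refine ⟨mfderivWithin 𝓘(ℝ, E') 𝓘(ℝ, E') (fun h => 𝒢.mul h k) {h | 𝒢.src h = 𝒢.tgt k} g, ?_⟩
  rintro c hc rfl hs
  have h1 := ((𝒢.contMDiffOn_mul_right k).mdifferentiableOn (by simp) (c 0)
    (hs 0)).hasMFDerivWithinAt
  have h2 := (hc.mdifferentiable (by simp) 0).hasMFDerivAt
  rw [← hasMFDerivWithinAt_univ] at h2
  have h3 := HasMFDerivWithinAt.comp (0 : ℝ) h1 h2 fun τ _ => hs τ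
  rw [hasMFDerivWithinAt_univ] at h3
  exact h3.mfderiv

/-- The vectors at an arrow that are tangent to the source fiber and to the target fiber. -/
def isotropySpace (g : G) : Submodule ℝ E' :=
  (D E' E 𝒢.src g).ker ⊓ (D E' E 𝒢.tgt g).ker

/-- Right multiplication by `k` maps a source fiber to a source fiber, preserves targets and is
undone by right multiplication by `inv k`. Applied to curves in the fiber, this gives the three
properties of `R` on `ker ds`; off `ker ds` nothing is claimed. -/
theorem exists_rightTranslation {g k : G} (hgk : 𝒢.src g = 𝒢.tgt k) :
    ∃ R : E' →L[ℝ] E', ∀ a, D E' E 𝒢.src g a = 0 →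
      D E' E 𝒢.src (𝒢.mul g k) (R a) = 0 ∧
      D E' E 𝒢.tgt (𝒢.mul g k) (R a) = D E' E 𝒢.tgt g a ∧ (R a = 0 → a = 0) := by
  obtain ⟨R, hR⟩ := 𝒢.exists_deriv_mul_right g k hgk
  obtain ⟨R', hR'⟩ := 𝒢.exists_deriv_mul_right (𝒢.mul g k) (𝒢.inv k)
    (by rw [𝒢.src_mul g k hgk, 𝒢.tgt_inv])
  refine ⟨R, fun a ha => ?_⟩
  obtain ⟨c, hc, hc0, hcs, hca⟩ := exists_curve_in_fiber 𝒢.submersion_src ha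
  have hcs' : ∀ τ, 𝒢.src (c τ) = 𝒢.tgt k := fun τ => (hcs τ).trans hgk
  have hck : ContMDiff 𝓘(ℝ, ℝ) 𝓘(ℝ, E') ∞ fun τ => 𝒢.mul (c τ) k :=
    (𝒢.contMDiffOn_mul_right k).comp_contMDiff hc hcs'
  have h0 : (∞ : WithTop ℕ∞) ≠ 0 := by simp
  have hRa : D ℝ E' (fun τ => 𝒢.mul (c τ) k) 0 1 = R a := by
    rw [hR c hc hc0 hcs', ContinuousLinearMap.comp_apply, hca]
  have hck0 : 𝒢.mul (c 0) k = 𝒢.mul g k := by rw [hc0]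
  have hmd := hck.mdifferentiable h0 0
  refine ⟨?_, ?_, fun h => ?_⟩
  · have h := D_comp (𝒢.smooth_src.mdifferentiable h0 _) hmd hck0
    rw [← hRa, ← ContinuousLinearMap.comp_apply, ← h]
    have hconst : (fun τ => 𝒢.src (𝒢.mul (c τ) k)) = fun _ => 𝒢.src k :=
      funext fun τ => 𝒢.src_mul _ _ (hcs' τ)
    rw [hconst]
    exact DFunLike.congr_fun mfderiv_const _
  · have h := D_comp (𝒢.smooth_tgt.mdifferentiable h0 _) hmd hck0
    have h' := D_comp (𝒢.smooth_tgt.mdifferentiable h0 _) (hc.mdifferentiable h0 0) hc0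
    rw [← hRa, ← ContinuousLinearMap.comp_apply, ← h, ← hca, ← ContinuousLinearMap.comp_apply, ← h']
    have heq : (fun τ => 𝒢.tgt (𝒢.mul (c τ) k)) = fun τ => 𝒢.tgt (c τ) :=
      funext fun τ => 𝒢.tgt_mul _ _ (hcs' τ)
    rw [heq]
  · have h := hR' _ hck hck0 fun τ => by rw [𝒢.src_mul _ _ (hcs' τ), 𝒢.tgt_inv]
    have heq : (fun τ => 𝒢.mul (𝒢.mul (c τ) k) (𝒢.inv k)) = c :=
      funext fun τ => 𝒢.mul_mul_inv (hcs' τ)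
    rw [heq] at h
    rw [← hca, h, ContinuousLinearMap.comp_apply, hRa, ‹R a = 0›, map_zero]

/-- The image of the source fiber tangent space under the target map is determined by the target
point. -/
theorem exists_unit_vector {g : G} {a : E'} (ha : D E' E 𝒢.src g a = 0) :
    ∃ b, D E' E 𝒢.src (𝒢.unit (𝒢.tgt g)) b = 0 ∧
      D E' E 𝒢.tgt (𝒢.unit (𝒢.tgt g)) b = D E' E 𝒢.tgt g a := by
  obtain ⟨R, hR⟩ := 𝒢.exists_rightTranslation (𝒢.tgt_inv g).symm
  rw [𝒢.mul_inv] at hR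
  exact ⟨R a, (hR a ha).1, (hR a ha).2.1⟩

variable [FiniteDimensional ℝ E']

theorem finrank_isotropySpace_le_of_map {g h : G} (R : E' →L[ℝ] E')
    (hR : ∀ a ∈ 𝒢.isotropySpace g, R a ∈ 𝒢.isotropySpace h ∧ (R a = 0 → a = 0)) :
    Module.finrank ℝ (𝒢.isotropySpace g) ≤ Module.finrank ℝ (𝒢.isotropySpace h) := by
  refine LinearMap.finrank_le_finrank_of_injective
    (f := R.toLinearMap.restrict (p := 𝒢.isotropySpace g) fun a ha => (hR a ha).1) ?_
  rw [← LinearMap.ker_eq_bot, LinearMap.ker_eq_bot']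
  intro a h0
  exact Subtype.ext ((hR a a.2).2 (congrArg Subtype.val h0))

theorem finrank_isotropySpace_mul_right_le {g k : G} (hgk : 𝒢.src g = 𝒢.tgt k) :
    Module.finrank ℝ (𝒢.isotropySpace g) ≤ Module.finrank ℝ (𝒢.isotropySpace (𝒢.mul g k)) := by
  obtain ⟨R, hR⟩ := 𝒢.exists_rightTranslation hgk
  exact 𝒢.finrank_isotropySpace_le_of_map R fun a ha =>
    ⟨⟨(hR a ha.1).1, (hR a ha.1).2.1.trans ha.2⟩, (hR a ha.1).2.2⟩

/-- Inversion is an involution that exchanges source and target, so it preserves the intersection of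
the two kernels. -/
theorem finrank_isotropySpace_le_inv (g : G) :
    Module.finrank ℝ (𝒢.isotropySpace g) ≤ Module.finrank ℝ (𝒢.isotropySpace (𝒢.inv g)) := by
  have h0 : (∞ : WithTop ℕ∞) ≠ 0 := by simp
  have hi := 𝒢.smooth_inv.mdifferentiable h0
  refine 𝒢.finrank_isotropySpace_le_of_map (D E' E' 𝒢.inv g) fun a ha => ⟨⟨?_, ?_⟩, fun h => ?_⟩
  · have h := D_comp (𝒢.smooth_src.mdifferentiable h0 _) (hi g) rfl
    simp only [𝒢.src_inv] at h
    exact (DFunLike.congr_fun h a).symm.trans ha.2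
  · have h := D_comp (𝒢.smooth_tgt.mdifferentiable h0 _) (hi g) rfl
    simp only [𝒢.tgt_inv] at h
    exact (DFunLike.congr_fun h a).symm.trans ha.1
  · have h' := D_comp (hi _) (hi g) rfl
    simp only [𝒢.inv_inv] at h'
    rw [D_id] at h'
    have := DFunLike.congr_fun h' a
    rw [ContinuousLinearMap.comp_apply, h, map_zero] at this
    exact this

/-- The dimension of the isotropy spaces is constant on source fibers. -/
theorem finrank_isotropySpace_eq {g h : G} (hgh : 𝒢.src g = 𝒢.src h) :
    Module.finrank ℝ (𝒢.isotropySpace g) = Module.finrank ℝ (𝒢.isotropySpace h) := by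
  have key : ∀ {g h : G}, 𝒢.src g = 𝒢.src h →
      Module.finrank ℝ (𝒢.isotropySpace g) ≤ Module.finrank ℝ (𝒢.isotropySpace h) := by
    intro g h hgh
    -- The dimension does not drop along `g`, `g⁻¹`, `g⁻¹(gh⁻¹) = h⁻¹`, `h`: two inversions and one
    -- right translation.
    have h1 : 𝒢.src g = 𝒢.tgt (𝒢.inv h) := by rw [hgh, 𝒢.tgt_inv]
    have h2 : 𝒢.src (𝒢.inv g) = 𝒢.tgt (𝒢.mul g (𝒢.inv h)) := by
      rw [𝒢.src_inv, 𝒢.tgt_mul _ _ h1]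
    have h3 := 𝒢.finrank_isotropySpace_mul_right_le h2
    rw [𝒢.inv_mul_mul h1] at h3
    have h4 := 𝒢.finrank_isotropySpace_le_inv (𝒢.inv h)
    rw [𝒢.inv_inv] at h4
    exact (𝒢.finrank_isotropySpace_le_inv g).trans (h3.trans h4)
  exact le_antisymm (key hgh) (key hgh.symm)

end Translations

end LieGroupoid

namespace LieGroupoid

/-! ### Curves in leaves -/

section Leaves

variable {E : Type*} [NormedAddCommGroup E] [NormedSpace ℝ E]
  {E' : Type*} [NormedAddCommGroup E'] [NormedSpace ℝ E']
  {M : Type*} [TopologicalSpace M] [ChartedSpace E M]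
  {G : Type*} [TopologicalSpace G] [ChartedSpace E' G]
  (𝒢 : LieGroupoid E E' M G)

section Plaques

variable {g : G} (C : SubmersionChart E E' 𝒢.src g) (e : OpenPartialHomeomorph M E)

/-- The target map on a source fiber, written in charts. -/
def tgtInFiber (w : C.proj.ker) : E := e (𝒢.tgt (C.fiberMap w))

/-- The domain on which the target map on a source fiber is written in charts. -/
def tgtDomain : Set C.proj.ker := C.fiberDomain ∩ {w | 𝒢.tgt (C.fiberMap w) ∈ e.source}

theorem isOpen_tgtDomain : IsOpen (𝒢.tgtDomain C e) :=
  (𝒢.smooth_tgt.continuous.comp_continuousOn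
    C.contMDiffOn_fiberMap.continuousOn).isOpen_inter_preimage C.isOpen_fiberDomain e.open_source

variable {C e} (he : e ∈ IsManifold.maximalAtlas 𝓘(ℝ, E) ∞ M) {w : C.proj.ker}
  (hw : w ∈ 𝒢.tgtDomain C e)
include he hw

theorem contDiffAt_tgtInFiber : ContDiffAt ℝ ∞ (𝒢.tgtInFiber C e) w :=
  ((contMDiffAt_of_mem_maximalAtlas he hw.2).comp w (𝒢.smooth_tgt.contMDiffAt.comp w
    (C.contMDiffOn_fiberMap.contMDiffAt (C.isOpen_fiberDomain.mem_nhds hw.1)))).contDiffAt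

theorem fderiv_tgtInFiber (v : C.proj.ker) : fderiv ℝ (𝒢.tgtInFiber C e) w v =
    D E E e (𝒢.tgt (C.fiberMap w)) (D E' E 𝒢.tgt (C.fiberMap w)
      (D C.proj.ker E' C.fiberMap w v)) := by
  have h1 := (C.contMDiffOn_fiberMap.contMDiffAt
    (C.isOpen_fiberDomain.mem_nhds hw.1)).mdifferentiableAt (n := ∞) (by simp)
  have h2 := 𝒢.smooth_tgt.mdifferentiable (by simp) (C.fiberMap w)
  rw [← ContinuousLinearMap.comp_apply (D E' E 𝒢.tgt _), ← D_comp h2 h1 rfl, ← D_eq_fderiv]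
  exact DFunLike.congr_fun (D_comp ((mdifferentiable_of_mem_maximalAtlas he).mdifferentiableAt hw.2)
    (h2.comp w h1) rfl) v

/-- The parametrization identifies its tangent vectors with `ker ds`, so the kernel becomes `ker ds
∩ ker dt`. Combined with `finrank_isotropySpace_eq`, this makes the rank of `t` on a source fiber
constant. -/
theorem finrank_ker_fderiv_tgtInFiber :
    Module.finrank ℝ (fderiv ℝ (𝒢.tgtInFiber C e) w).ker =
      Module.finrank ℝ (𝒢.isotropySpace (C.fiberMap w)) := by
  have hinj := C.injective_D_fiberMap hw.1
  have hmap : (fderiv ℝ (𝒢.tgtInFiber C e) w).ker.map (D C.proj.ker E' C.fiberMap w).toLinearMap =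
      𝒢.isotropySpace (C.fiberMap w) := by
    have hzero : ∀ v, v ∈ (fderiv ℝ (𝒢.tgtInFiber C e) w).ker ↔
        D E' E 𝒢.tgt (C.fiberMap w) (D C.proj.ker E' C.fiberMap w v) = 0 := by
      intro v
      rw [LinearMap.mem_ker]
      change fderiv ℝ (𝒢.tgtInFiber C e) w v = 0 ↔ _
      rw [𝒢.fderiv_tgtInFiber he hw]
      refine ⟨fun h => ?_, fun h => by rw [h, map_zero]⟩
      rw [← D_symm_D he hw.2 (D E' E 𝒢.tgt _ _), h, map_zero]
    have hr := C.range_D_fiberMap 𝒢.smooth_src hw.1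
    ext a
    constructor
    · rintro ⟨v, hv, rfl⟩
      exact ⟨hr ▸ ⟨v, rfl⟩, (hzero v).1 hv⟩
    · rintro ⟨ha, ha'⟩
      rw [← hr] at ha
      obtain ⟨v, rfl⟩ := ha
      exact ⟨v, (hzero v).2 ha', rfl⟩
  rw [← hmap]
  exact (LinearEquiv.finrank_eq (Submodule.equivMapOfInjective _ hinj _))

end Plaques

/-- Each arrow has a neighborhood `U` in its source fiber such that differentiable curves in the
target image of `U` are tangent to the target image of the source fiber. -/
theorem exists_plaque [FiniteDimensional ℝ E] [FiniteDimensional ℝ E'] [IsManifold 𝓘(ℝ, E) ∞ M]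
    (g : G) : ∃ U : Set G, IsOpen U ∧ g ∈ U ∧
      TopologicalSpace.IsSeparable {h : 𝒢.src ⁻¹' {𝒢.src g} | (h : G) ∈ U} ∧
      ∀ (γ : ℝ → M) (S : Set ℝ), (∀ σ ∈ S, ∃ h ∈ U, 𝒢.src h = 𝒢.src g ∧ 𝒢.tgt h = γ σ) →
        ∀ σ ∈ S, AccPt σ (𝓟 S) → MDifferentiableAt 𝓘(ℝ, ℝ) 𝓘(ℝ, E) γ σ →
          ∃ h a, 𝒢.tgt h = γ σ ∧ D E' E 𝒢.src h a = 0 ∧ D E' E 𝒢.tgt h a = D ℝ E γ σ 1 := by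
  obtain ⟨C⟩ := nonempty_submersionChart 𝒢.submersion_src g
  set e := chartAt E (𝒢.tgt g) with he_def
  have he : e ∈ IsManifold.maximalAtlas 𝓘(ℝ, E) ∞ M := IsManifold.chart_mem_maximalAtlas _
  have h0 : (0 : C.proj.ker) ∈ 𝒢.tgtDomain C e :=
    ⟨C.zero_mem_fiberDomain, by simp [he_def]⟩
  have hΩ := (𝒢.isOpen_tgtDomain C e).mem_nhds h0
  obtain ⟨W, τ, hWo, h0W, hWΩ, hτ⟩ := exists_generalizedInverse_of_constant_rank
    (𝒢.contDiffAt_tgtInFiber he h0) (by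
      filter_upwards [hΩ] with w hw
      rw [𝒢.finrank_ker_fderiv_tgtInFiber he hw, 𝒢.finrank_ker_fderiv_tgtInFiber he h0]
      exact 𝒢.finrank_isotropySpace_eq ((C.map_fiberMap hw.1).trans (C.map_fiberMap h0.1).symm)) hΩ
  have hWD : W ⊆ C.fiberDomain := fun w hw => (hWΩ hw).1
  obtain ⟨U, hU, hUW⟩ := C.exists_isOpen_inter_fiber hWo hWD
  refine ⟨U, hU, ?_, ?_, ?_⟩
  · have : g ∈ U ∩ 𝒢.src ⁻¹' {𝒢.src g} := hUW ▸ ⟨0, h0W, C.fiberMap_zero⟩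
    exact this.1
  · let j : W → 𝒢.src ⁻¹' {𝒢.src g} := fun w => ⟨C.fiberMap w, C.map_fiberMap (hWD w.2)⟩
    have hj : Continuous j :=
      (C.contMDiffOn_fiberMap.continuousOn.mono hWD).domRestrict.subtype_mk _
    refine (TopologicalSpace.isSeparable_range hj).mono ?_
    intro h hh
    have : (h : G) ∈ U ∩ 𝒢.src ⁻¹' {𝒢.src g} := ⟨hh, h.2⟩
    rw [hUW] at this
    obtain ⟨w, hw, hwh⟩ := this
    exact ⟨⟨w, hw⟩, Subtype.ext hwh⟩
  · intro γ S hS σ hσ hacc hγ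
    have hSW : ∀ σ ∈ S, ∃ w ∈ W, 𝒢.tgt (C.fiberMap w) = γ σ := by
      intro σ hσ
      obtain ⟨h, hhU, hs, ht⟩ := hS σ hσ
      have : h ∈ U ∩ 𝒢.src ⁻¹' {𝒢.src g} := ⟨hhU, hs⟩
      rw [hUW] at this
      obtain ⟨w, hw, rfl⟩ := this
      exact ⟨w, hw, ht⟩
    obtain ⟨w, hw, hwσ⟩ := hSW σ hσ
    have hγe : γ σ ∈ e.source := hwσ ▸ (hWΩ hw).2
    obtain ⟨hτd, hτΩ, hττ⟩ := hτ w hw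
    have hfw : 𝒢.tgtInFiber C e w = e (γ σ) := congrArg e hwσ
    rw [hfw] at hτd hτΩ hττ
    have hb : HasDerivAt (fun σ => e (γ σ)) (D E E e (γ σ) (D ℝ E γ σ 1)) σ := by
      have hed := (mdifferentiable_of_mem_maximalAtlas he).mdifferentiableAt hγe
      have h1 := D_comp hed hγ rfl
      rw [← ContinuousLinearMap.comp_apply, ← h1, D_eq_fderiv]
      exact (hed.comp σ hγ).differentiableAt.hasFDerivAt.hasDerivAt
    have hb2 := ((𝒢.contDiffAt_tgtInFiber he hτΩ).differentiableAt
      (by simp)).hasFDerivAt.comp_hasDerivAt σ (hτd.hasFDerivAt.comp_hasDerivAt σ hb)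
    -- On `S` the curve agrees with its image under `t ∘ τ`, read in charts. At an accumulation
    -- point the derivatives agree, and the second one visibly comes from a vector tangent to the
    -- source fiber.
    have heq : EqOn (fun σ => e (γ σ)) (𝒢.tgtInFiber C e ∘ τ ∘ fun σ => e (γ σ)) S := by
      intro σ' hσ'
      obtain ⟨w', hw', hwσ'⟩ := hSW σ' hσ'
      have := (hτ w' hw').2.2
      rw [show 𝒢.tgtInFiber C e w' = e (γ σ') from congrArg e hwσ'] at this
      exact this.symm
    have hder := deriv_eq_of_accPt heq hσ hacc hb hb2
    rw [𝒢.fderiv_tgtInFiber he hτΩ] at hder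
    have htgt : 𝒢.tgt (C.fiberMap (τ (e (γ σ)))) = γ σ := e.injOn hτΩ.2 hγe hττ
    have hr := C.range_D_fiberMap 𝒢.smooth_src hτΩ.1
    generalize fderiv ℝ τ (e (γ σ)) _ = v at hder
    refine ⟨_, D C.proj.ker E' C.fiberMap (τ (e (γ σ))) v, htgt, ?_, ?_⟩
    · exact LinearMap.mem_ker.1 (hr ▸ ⟨v, rfl⟩)
    · rw [htgt] at hder
      have := congrArg (D E E e.symm (e (γ σ))) hder
      rw [D_symm_D he hγe, D_symm_D he hγe] at this
      exact this.symm

/-- The target map from a source fiber to an orbit is an open quotient map. -/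
theorem isOpenQuotientMap_toOrbit (x : M) :
    @IsOpenQuotientMap _ _ _ (𝒢.orbitTopology x) (𝒢.toOrbit x) := by
  let := 𝒢.orbitTopology x
  refine ⟨?_, continuous_coinduced_rng, ?_⟩
  · rintro ⟨_, g, hg, rfl⟩
    exact ⟨⟨g, hg⟩, rfl⟩
  intro V hV
  refine isOpen_coinduced.2 ?_
  -- The saturation of `V` is the union of its preimages under right multiplication by the arrows
  -- `k` from `x` to `x`; if `h` and `v` have the same target, then `k = h⁻¹v`.
  have hunion : 𝒢.toOrbit x ⁻¹' (𝒢.toOrbit x '' V) = ⋃ k : {k // 𝒢.src k = x ∧ 𝒢.tgt k = x},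
      {h : 𝒢.src ⁻¹' {x} | ∃ hk, (⟨𝒢.mul h k, hk⟩ : 𝒢.src ⁻¹' {x}) ∈ V} := by
    ext h
    rw [mem_iUnion]
    have hh : 𝒢.src h = x := h.2
    constructor
    · rintro ⟨v, hv, hvh⟩
      have hvh : 𝒢.tgt v = 𝒢.tgt h := congrArg Subtype.val hvh
      have hvx : 𝒢.src v = x := v.2
      have h1 : 𝒢.src (𝒢.inv h) = 𝒢.tgt v := by rw [𝒢.src_inv, hvh]
      have h2 : 𝒢.mul h (𝒢.mul (𝒢.inv h) v) = v := by
        have := 𝒢.inv_mul_mul h1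
        rwa [𝒢.inv_inv] at this
      refine ⟨⟨𝒢.mul (𝒢.inv h) v, by rw [𝒢.src_mul _ _ h1, hvx], by
        rw [𝒢.tgt_mul _ _ h1, 𝒢.tgt_inv, hh]⟩, ?_⟩
      refine ⟨by rw [h2]; exact v.2, ?_⟩
      convert hv
    · rintro ⟨k, hk, hkV⟩
      exact ⟨_, hkV, Subtype.ext (𝒢.tgt_mul _ _ (hh.trans k.2.2.symm))⟩
  rw [hunion]
  refine isOpen_iUnion fun k => ?_
  have hs : ∀ h : 𝒢.src ⁻¹' {x}, 𝒢.src h = 𝒢.tgt k := fun h =>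
    (show 𝒢.src h = x from h.2).trans k.2.2.symm
  have hk : ∀ h : 𝒢.src ⁻¹' {x}, 𝒢.src (𝒢.mul h k) = x := fun h =>
    (𝒢.src_mul _ _ (hs h)).trans k.2.1
  have hcont : Continuous fun h : 𝒢.src ⁻¹' {x} => (⟨𝒢.mul h k, hk h⟩ : 𝒢.src ⁻¹' {x}) :=
    ((𝒢.contMDiffOn_mul_right (k : G)).continuousOn.comp_continuous continuous_subtype_val
      hs).subtype_mk _
  convert hV.preimage hcont using 1
  ext h
  exact ⟨fun ⟨_, h⟩ => h, fun h' => ⟨hk h, h'⟩⟩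

variable [FiniteDimensional ℝ E] [FiniteDimensional ℝ E'] [IsManifold 𝓘(ℝ, E) ∞ M]
  [T2Space M] [SecondCountableTopology M]

/-- The velocities of a differentiable curve in a leaf are tangent to the target images of source
fibers, at a dense set of times. -/
theorem dense_velocity_of_mem_leaf {x : M} {γ : ℝ → M}
    (hγ : MDifferentiable 𝓘(ℝ, ℝ) 𝓘(ℝ, E) γ) (hx : ∀ σ, γ σ ∈ 𝒢.leaf x) :
    Dense {σ | ∃ h a, 𝒢.tgt h = γ σ ∧ D E' E 𝒢.src h a = 0 ∧
      D E' E 𝒢.tgt h a = D ℝ E γ σ 1} := by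
  let := 𝒢.orbitTopology x
  have hquot := 𝒢.isOpenQuotientMap_toOrbit x
  have := locallyConnectedSpace_fiber 𝒢.submersion_src x
  have : LocallyConnectedSpace (𝒢.orbit x) :=
    hquot.isQuotientMap.isCoinducing.locallyConnectedSpace
  have : LocallyCompactSpace G := ChartedSpace.locallyCompactSpace E' G
  have : LocallyCompactSpace (𝒢.src ⁻¹' {x}) :=
    (isClosed_singleton.preimage 𝒢.smooth_src.continuous).locallyCompactSpace
  have : LocallyCompactSpace (𝒢.orbit x) := hquot.locallyCompactSpace
  have hval : Continuous (Subtype.val : 𝒢.orbit x → M) :=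
    hquot.isQuotientMap.continuous_iff.2
      (𝒢.smooth_tgt.continuous.comp continuous_subtype_val)
  choose U hUo hU hUs hUγ using 𝒢.exists_plaque
  -- Source fibers need not be second countable; countability comes from the injection of the orbit
  -- into `M`.
  let Q : 𝒢.src ⁻¹' {x} → Set (𝒢.orbit x) := fun g => 𝒢.toOrbit x '' {h | (h : G) ∈ U g}
  obtain ⟨c, hc, hcov⟩ := exists_countable_cover_connectedComponent hval Subtype.val_injective Q
    (fun g => hquot.isOpenMap _ ((hUo g).preimage continuous_subtype_val))
    (fun g => by
      have hs := hUs g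
      obtain ⟨g, rfl⟩ := g
      exact hs.image hquot.continuous)
    (fun y => by
      obtain ⟨g, rfl⟩ := hquot.surjective y
      exact ⟨g, g, hU g, rfl⟩)
    (𝒢.toOrbit x ⟨𝒢.unit x, 𝒢.src_unit x⟩)
  refine (dense_setOf_accPt hc (C := fun g => {σ | ∃ h ∈ U g, 𝒢.src h = 𝒢.src g ∧ 𝒢.tgt h = γ σ})
    fun σ => ?_).mono ?_
  · obtain ⟨y, hy, hyσ⟩ := hx σ
    obtain ⟨g, hgc, h, hh, rfl⟩ := mem_iUnion₂.1 (hcov hy)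
    exact ⟨g, hgc, h, hh, (show 𝒢.src h = x from h.2).trans (show 𝒢.src g = x from g.2).symm, hyσ⟩
  · rintro σ ⟨g, -, hσ, hacc⟩
    exact hUγ g γ _ (fun _ h => h) σ hσ hacc (hγ σ)

end Leaves

end LieGroupoid

/-! ### Basic forms of Lie groupoids are basic for the induced foliations -/

section Radical

variable {E : Type*} [NormedAddCommGroup E] [NormedSpace ℝ E]
  {M : Type*} [TopologicalSpace M] [ChartedSpace E M] {k : ℕ}

/-- The vectors at `x` whose contraction with a form vanishes. -/
def Form.radical (β : Form E M k) (x : M) : Submodule ℝ E where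
  carrier := {a | ∀ (v : Fin k → E) (i : Fin k), v i = a → β.eval x v = 0}
  zero_mem' := fun _ i h => (β.eval x).map_coord_zero i h
  add_mem' := by
    intro a b ha hb v i h
    rw [← Function.update_eq_self i v, h, ContinuousAlternatingMap.map_update_add,
      ha _ i (Function.update_self ..), hb _ i (Function.update_self ..), add_zero]
  smul_mem' := by
    intro c a ha v i h
    rw [← Function.update_eq_self i v, h, ContinuousAlternatingMap.map_update_smul,
      ha _ i (Function.update_self ..), smul_zero]

/-- The contraction fills only the first slot; a transposition brings any other slot there at the
cost of a sign. -/
theorem Form.mem_radical_iff_contract {β : Form E M (k + 1)} {X : ∀ x : M, TangentSpace 𝓘(ℝ, E) x}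
    {x : M} : (X x : E) ∈ β.radical x ↔ β.contract X x = 0 := by
  constructor
  · intro h
    refine ContinuousAlternatingMap.ext fun v => ?_
    exact h (Matrix.vecCons (X x : E) v) 0 rfl
  · intro h v i hi
    by_cases h0 : i = 0
    · subst h0
      have := DFunLike.congr_fun h (Fin.tail v)
      rw [← Fin.cons_self_tail v, hi]
      exact this
    · have hswap := (β.eval x).toAlternatingMap.map_swap v (Ne.symm h0)
      have h2 : (β.eval x) (v ∘ Equiv.swap 0 i) = 0 := by
        have := DFunLike.congr_fun h (Fin.tail (v ∘ Equiv.swap 0 i))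
        rw [← Fin.cons_self_tail (v ∘ Equiv.swap 0 i)]
        have h3 : (v ∘ Equiv.swap 0 i) 0 = X x := by simpa using hi
        rw [h3]
        exact this
      have h4 : (β.eval x) (v ∘ Equiv.swap 0 i) = -(β.eval x) v := hswap
      rw [h2] at h4
      exact neg_eq_zero.1 h4.symm

theorem extDeriv_eq_zero_of_eventuallyEq_zero {β : E → E [⋀^Fin k]→L[ℝ] ℝ} {y : E}
    (h : β =ᶠ[𝓝 y] 0) : extDeriv β y = 0 := by
  have h0 : fderiv ℝ (0 : E → E [⋀^Fin k]→L[ℝ] ℝ) y = 0 := fderiv_const_apply 0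
  rw [h.extDeriv_eq, extDeriv, h0]
  exact (ContinuousAlternatingMap.alternatizeUncurryFinCLM ℝ E ℝ).map_zero

/-- The exterior derivative of a form vanishes on each open set on which the form vanishes. -/
theorem Form.d_eq_zero_of_eqOn_zero {β : Form E M k} {U : Set M} (hU : IsOpen U)
    (h : ∀ x ∈ U, β x = 0) {x : M} (hx : x ∈ U) : β.d x = 0 := by
  have hmem : chartAt E x x ∈ (chartAt E x).target := (chartAt E x).map_source (mem_chart_source E x)
  have hz : β.inChart (chartAt E x) =ᶠ[𝓝 (chartAt E x x)] 0 := by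
    have hcont := (chartAt E x).symm.continuousAt hmem
    have hU' : U ∈ 𝓝 ((chartAt E x).symm (chartAt E x x)) := by
      rw [(chartAt E x).left_inv (mem_chart_source E x)]
      exact hU.mem_nhds hx
    filter_upwards [hcont.preimage_mem_nhds hU'] with y hy
    ext v
    rw [Form.inChart_eq]
    exact DFunLike.congr_fun (h _ hy) _
  change β.d.eval x = 0
  rw [Form.d_eval, extDeriv_eq_zero_of_eventuallyEq_zero hz]
  rfl

/-- The Lie derivative along a vector field that is annihilated by a form and its exterior
derivative vanishes. -/
theorem Form.lieDeriv_eq_zero {α : Form E M k} {X : ∀ x : M, TangentSpace 𝓘(ℝ, E) x} {U : Set M}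
    (hU : IsOpen U) (h : ∀ x ∈ U, (X x : E) ∈ α.radical x)
    (hd : ∀ x ∈ U, (X x : E) ∈ α.d.radical x) {x : M} (hx : x ∈ U) :
    α.ContractVanishesAt X x ∧ α.lieDeriv X x = 0 := by
  have h1 := Form.mem_radical_iff_contract.1 (hd x hx)
  cases k with
  | zero => exact ⟨trivial, h1⟩
  | succ k =>
    have h2 : ∀ y ∈ U, α.contract X y = 0 := fun y hy => Form.mem_radical_iff_contract.1 (h y hy)
    refine ⟨h2 x hx, ?_⟩
    change α.d.contract X x + (α.contract X).d x = 0
    rw [h1, Form.d_eq_zero_of_eqOn_zero hU h2 hx, add_zero]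

/-- The velocity of a smooth curve is annihilated by a continuous form if the velocities at a dense
set of times are. -/
theorem Form.velocity_mem_radical_of_dense [IsManifold 𝓘(ℝ, E) ∞ M] {β : Form E M k}
    (hβ : ∀ e ∈ atlas E M, ContinuousOn (β.inChart e) e.target) {γ : ℝ → M}
    (hγ : ContMDiff 𝓘(ℝ, ℝ) 𝓘(ℝ, E) ∞ γ)
    (hdense : Dense {σ | D ℝ E γ σ 1 ∈ β.radical (γ σ)}) (τ : ℝ) :
    D ℝ E γ τ 1 ∈ β.radical (γ τ) := by
  intro v i hvi
  set e := chartAt E (γ τ)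
  have hτe : γ τ ∈ e.source := mem_chart_source E _
  have he : e ∈ IsManifold.maximalAtlas 𝓘(ℝ, E) ∞ M := IsManifold.chart_mem_maximalAtlas _
  let w : Fin k → E := fun j => D E E e (γ τ) (v j)
  let b : ℝ → E := fun σ => e (γ σ)
  have hderiv : ∀ σ, γ σ ∈ e.source → deriv b σ = D E E e (γ σ) (D ℝ E γ σ 1) := by
    intro σ hσ
    have h1 := D_comp ((mdifferentiable_of_mem_maximalAtlas he).mdifferentiableAt hσ)
      (hγ.mdifferentiable (by simp) σ) rfl
    rw [← ContinuousLinearMap.comp_apply, ← h1, D_eq_fderiv]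
    exact (fderiv_apply_one_eq_deriv).symm
  have hb : ContDiffAt ℝ ∞ b τ :=
    ((contMDiffAt_of_mem_maximalAtlas he hτe).comp τ hγ.contMDiffAt).contDiffAt
  have hb' : ContinuousAt (deriv b) τ := by
    have : ContinuousAt (fun σ => fderiv ℝ b σ 1) τ :=
      (hb.fderiv_right (m := 0) (by simp)).continuousAt.clm_apply continuousAt_const
    simpa only [fderiv_apply_one_eq_deriv] using this
  -- The other arguments are frozen in the chart while the moving velocity fills slot `i`. This
  -- function is continuous at `τ` and vanishes at a dense set of nearby times.
  let F : ℝ → ℝ := fun σ => β.inChart e (b σ) (Function.update w i (deriv b σ))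
  have hF : ContinuousAt F τ := by
    have h1 : ContinuousAt (fun σ => β.inChart e (b σ)) τ :=
      ContinuousAt.comp (f := b) (g := β.inChart e) ((hβ e (chart_mem_atlas E _)).continuousAt
        (e.open_target.mem_nhds (e.map_source hτe))) hb.continuousAt
    have h2 : ContinuousAt (fun σ => Function.update w i (deriv b σ)) τ :=
      continuousAt_const.update i hb'
    exact h1.eval h2
  have hFτ : F τ = β.eval (γ τ) v := by
    have hu : Function.update w i (deriv b τ) = w := by
      rw [hderiv τ hτe, ← hvi]
      exact Function.update_eq_self i w
    change β.inChart e (e (γ τ)) (Function.update w i (deriv b τ)) = _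
    rw [hu, Form.inChart_eq, e.left_inv hτe]
    simp [w, Function.comp_def, D_symm_D he hτe]
  rw [← hFτ]
  by_contra hne
  have hev : ∀ᶠ σ in 𝓝 τ, F σ ≠ 0 ∧ γ σ ∈ e.source :=
    (hF.eventually_ne hne).and
      (hγ.continuous.continuousAt.preimage_mem_nhds (e.open_source.mem_nhds hτe))
  obtain ⟨σ, hσ, hσF, hσe⟩ := hdense.inter_nhds_nonempty hev
  refine hσF ?_
  change β.inChart e (e (γ σ)) (Function.update w i (deriv b σ)) = 0
  rw [Form.inChart_eq, e.left_inv hσe]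
  refine hσ _ i ?_
  change D E E e.symm (e (γ σ)) (Function.update w i (deriv b σ) i) = _
  rw [Function.update_self, hderiv σ hσe, D_symm_D he hσe]

end Radical

namespace LieGroupoid

section Basic

variable {E : Type*} [NormedAddCommGroup E] [NormedSpace ℝ E]
  {E' : Type*} [NormedAddCommGroup E'] [NormedSpace ℝ E']
  {M : Type*} [TopologicalSpace M] [ChartedSpace E M]
  {G : Type*} [TopologicalSpace G] [ChartedSpace E' G]
  (𝒢 : LieGroupoid E E' M G) {k : ℕ}

theorem surjective_D_src (g : G) : Function.Surjective (D E' E 𝒢.src g) := by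
  obtain ⟨C⟩ := nonempty_submersionChart 𝒢.submersion_src g
  have hg := C.dom.map_source C.mem_source
  have hsg : 𝒢.src (C.dom.symm (C.dom g)) ∈ C.cod.source := C.mapsTo (C.dom.map_target hg)
  have h : fderiv ℝ (writtenIn C.dom C.cod 𝒢.src) (C.dom g) = C.proj := by
    refine ((C.proj.hasFDerivAt (x := C.dom g)).congr_of_eventuallyEq ?_).fderiv
    filter_upwards [C.dom.open_target.mem_nhds hg] with z hz using C.cod_map z hz
  rw [fderiv_writtenIn C.dom_mem C.cod_mem 𝒢.smooth_src hg hsg, C.dom.left_inv C.mem_source] at h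
  rw [C.dom.left_inv C.mem_source] at hsg
  intro v
  obtain ⟨w, hw⟩ := C.proj_surjective (D E E C.cod (𝒢.src g) v)
  refine ⟨D E' E' C.dom.symm (C.dom g) w, ?_⟩
  rw [← h] at hw
  have := congrArg (D E E C.cod.symm (C.cod (𝒢.src g))) hw
  simpa only [ContinuousLinearMap.comp_apply, D_symm_D C.cod_mem hsg] using this

theorem surjective_D_tgt (g : G) : Function.Surjective (D E' E 𝒢.tgt g) := by
  intro v
  obtain ⟨w, hw⟩ := 𝒢.surjective_D_src (𝒢.inv g) v
  have hi := 𝒢.smooth_inv.mdifferentiable (n := ∞) (by simp)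
  have h := D_comp (𝒢.smooth_tgt.mdifferentiable (n := ∞) (by simp) g) (hi (𝒢.inv g))
    (𝒢.inv_inv g)
  simp only [𝒢.tgt_inv] at h
  exact ⟨D E' E' 𝒢.inv (𝒢.inv g) w, by rw [← hw, h, ContinuousLinearMap.comp_apply]⟩

/-- The form is annihilated by the target images of the vectors tangent to source fibers. -/
def IsHorizontal (β : Form E M k) : Prop :=
  ∀ g a, D E' E 𝒢.src g a = 0 → D E' E 𝒢.tgt g a ∈ β.radical (𝒢.tgt g)

variable {𝒢}

/-- The remaining arguments lift through the surjective `dt`; on the lifts, `t^*β = s^*β` vanishes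
because `ds` kills `a`. -/
theorem IsBasic.isHorizontal {β : Form E M k} (hβ : 𝒢.IsBasic β) : 𝒢.IsHorizontal β := by
  intro g a ha v i hvi
  choose w hw using fun j => 𝒢.surjective_D_tgt g (v j)
  have h : (Form.pullback (E' := E') 𝒢.src β).eval g = (Form.pullback (E' := E') 𝒢.tgt β).eval g :=
    congrFun hβ g
  rw [Form.pullback_eval, Form.pullback_eval] at h
  have h2 := DFunLike.congr_fun h (Function.update w i a)
  have h3 : (fun j => D E' E 𝒢.tgt g (Function.update w i a j)) = v := by
    funext j
    by_cases hj : j = i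
    · subst hj
      rw [Function.update_self, hvi]
    · rw [Function.update_of_ne hj, hw]
  have h4 : β.eval (𝒢.src g) (fun j => D E' E 𝒢.src g (Function.update w i a j)) = 0 :=
    (β.eval (𝒢.src g)).map_coord_zero i (by rw [Function.update_self, ha])
  rw [← h3]
  exact h2.symm.trans h4

variable [IsManifold 𝓘(ℝ, E) ∞ M] [IsManifold 𝓘(ℝ, E') ∞ G]

theorem IsBasic.d {α : Form E M k} (hα : α.IsSmooth) (h : 𝒢.IsBasic α) : 𝒢.IsBasic α.d := by
  funext g
  have hψ : chartAt E' g ∈ IsManifold.maximalAtlas 𝓘(ℝ, E') ∞ G :=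
    IsManifold.chart_mem_maximalAtlas g
  have hg := mem_chart_source E' g
  refine Form.eq_of_inChart_eq hψ hg ?_
  have hy := (chartAt E' g).map_source hg
  rw [Form.pullback_d_inChart hψ 𝒢.smooth_src hα hy, Form.pullback_d_inChart hψ 𝒢.smooth_tgt hα hy]
  have h' : Form.pullback (E' := E') 𝒢.src α = Form.pullback (E' := E') 𝒢.tgt α := h
  rw [h']

omit [IsManifold 𝓘(ℝ, E') ∞ G]
variable [FiniteDimensional ℝ E] [FiniteDimensional ℝ E'] [T2Space M] [SecondCountableTopology M]

/-- The radical is a subspace, so velocities of curves suffice. They lie in `dt(ker ds)` at a dense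
set of times, and continuity of `β` does the rest. -/
theorem IsHorizontal.leafTangentSpace_le {β : Form E M k} (h : 𝒢.IsHorizontal β)
    (hβ : ∀ e ∈ atlas E M, ContinuousOn (β.inChart e) e.target) {x y : M}
    {v : TangentSpace 𝓘(ℝ, E) x} (hv : v ∈ leafTangentSpace E (𝒢.leaf y) x) :
    (v : E) ∈ β.radical x := by
  have hle : leafTangentSpace E (𝒢.leaf y) x ≤ β.radical x := by
    refine Submodule.span_le.2 ?_
    rintro v ⟨γ, hγ, hγL, hv⟩
    have hv' : (⟨γ 0, D ℝ E γ 0 1⟩ : TangentBundle 𝓘(ℝ, E) M) = ⟨x, v⟩ := hv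
    cases hv'
    refine Form.velocity_mem_radical_of_dense hβ hγ ?_ 0
    refine (𝒢.dense_velocity_of_mem_leaf (hγ.mdifferentiable (by simp)) hγL).mono ?_
    rintro σ ⟨g, a, hg, ha, hσ⟩
    have := h g a ha
    rwa [hg, hσ] at this
  exact hle hv

/-- The basic forms of a Lie groupoid are basic for its foliation. -/
theorem IsBasic.isFoliationBasic [IsManifold 𝓘(ℝ, E') ∞ G] {α : Form E M k} (hα : α.IsSmooth)
    (h : 𝒢.IsBasic α) : IsFoliationBasic 𝒢.foliation α := by
  intro U X hU _ hX x hx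
  refine Form.lieDeriv_eq_zero hU (fun y hy => ?_) (fun y hy => ?_) hx
  · obtain ⟨_, ⟨z, rfl⟩, -, hv⟩ := hX y hy
    exact h.isHorizontal.leafTangentSpace_le (fun e he => (hα e he).continuousOn) hv
  · obtain ⟨_, ⟨z, rfl⟩, -, hv⟩ := hX y hy
    exact (h.d hα).isHorizontal.leafTangentSpace_le (fun e he => hα.continuousOn_d_inChart he) hv

end Basic

end LieGroupoid

/-! ### Forms that are basic for the foliation are basic for the identity component -/

section Sections

variable {E : Type*} [NormedAddCommGroup E] [NormedSpace ℝ E]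
  {M : Type*} [TopologicalSpace M] [ChartedSpace E M] [IsManifold 𝓘(ℝ, E) ∞ M]
  {E' : Type*} [NormedAddCommGroup E'] [NormedSpace ℝ E'] {k : ℕ}

/-- The image of a constant vector field under a map `κ`, restricted to a section `r` of `κ`, is
smooth. -/
theorem contMDiffOn_pushforward_const {κ : E' → M} {T : Set E'} (hT : IsOpen T)
    (hκ : ContMDiffOn 𝓘(ℝ, E') 𝓘(ℝ, E) ∞ κ T) {r : M → E'} {U : Set M}
    (hr : ContMDiffOn 𝓘(ℝ, E) 𝓘(ℝ, E') ∞ r U) (hrU : MapsTo r U T) (hκr : ∀ z ∈ U, κ (r z) = z)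
    (c : E') :
    ContMDiffOn 𝓘(ℝ, E) (𝓘(ℝ, E).prod 𝓘(ℝ, E)) ∞
      (fun z => (⟨z, D E' E κ (r z) c⟩ : TangentBundle 𝓘(ℝ, E) M)) U := by
  have h1 : ContMDiffOn 𝓘(ℝ, E') 𝓘(ℝ, E').tangent ∞
      (fun y : E' => (⟨y, c⟩ : TangentBundle 𝓘(ℝ, E') E')) univ :=
    (contMDiff_vectorSpace_iff_contDiff (V := fun _ => c)).2 contDiff_const |>.contMDiffOn
  have h2 := hκ.contMDiffOn_tangentMapWithin (m := ∞) (by simp) hT.uniqueMDiffOn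
  have h3 : ContMDiffOn 𝓘(ℝ, E) 𝓘(ℝ, E').tangent ∞
      (fun z => (⟨r z, c⟩ : TangentBundle 𝓘(ℝ, E') E')) U := h1.comp hr fun _ _ => mem_univ _
  refine (h2.comp h3 fun z hz => hrU hz).congr fun z hz => ?_
  have h4 : mfderivWithin 𝓘(ℝ, E') 𝓘(ℝ, E) κ T (r z) = mfderiv 𝓘(ℝ, E') 𝓘(ℝ, E) κ (r z) :=
    mfderivWithin_of_isOpen hT (hrU hz)
  have h5 : ∀ {p q : M} (w : E), p = q →
      (⟨p, w⟩ : TangentBundle 𝓘(ℝ, E) M) = ⟨q, w⟩ := by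
    rintro p _ w rfl
    rfl
  change _ = (⟨κ (r z), mfderivWithin 𝓘(ℝ, E') 𝓘(ℝ, E) κ T (r z) c⟩ : TangentBundle 𝓘(ℝ, E) M)
  rw [h4]
  exact h5 _ (hκr z hz).symm

omit [IsManifold 𝓘(ℝ, E) ∞ M]

/-- The arguments are exchanged one at a time. -/
theorem Form.eval_congr_of_sub_mem_radical {β : Form E M k} {x : M} {v w : Fin k → E}
    (h : ∀ i, v i - w i ∈ β.radical x) : β.eval x v = β.eval x w := by
  have key : ∀ s : Finset (Fin k), β.eval x (s.piecewise v w) = β.eval x w := by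
    intro s
    induction s using Finset.induction_on with
    | empty => simp
    | insert i s hi ih =>
      rw [Finset.piecewise_insert]
      have h1 : s.piecewise v w = Function.update (s.piecewise v w) i (w i) := by
        conv_lhs => rw [← Function.update_eq_self i (s.piecewise v w)]
        rw [Finset.piecewise_eq_of_notMem _ _ _ hi]
      rw [← ih, h1, Function.update_idem, ← sub_eq_zero,
        ← ContinuousAlternatingMap.map_update_sub]
      exact h i _ i (Function.update_self ..)
  simpa using key Finset.univ

/-- If a form on a vector space and its exterior derivative are annihilated by a constant vector,
then the form is constant in the direction of this vector. -/
theorem fderiv_apply_eq_zero_of_extDeriv {β : E → E [⋀^Fin k]→L[ℝ] ℝ} {y a : E}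
    (hβ : DifferentiableAt ℝ β y) (h : ∀ᶠ z in 𝓝 y, ∀ v i, v i = a → β z v = 0)
    (hd : ∀ v i, v i = a → extDeriv β y v = 0) (u : Fin k → E) :
    fderiv ℝ (fun z => β z u) y a = 0 := by
  -- In the expansion of `dβ(a, u)` the first term is the derivative of `β(u)` along `a`. The others
  -- differentiate values of `β` with `a` among the arguments, which vanish near `y`.
  have h1 := extDeriv_apply hβ (Fin.cons a u : Fin (k + 1) → E)
  rw [hd _ 0 rfl, Fin.sum_univ_succ, Finset.sum_eq_zero, add_zero] at h1
  · simpa using h1.symm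
  · intro i _
    have hk : NeZero k := ⟨fun h0 => by subst h0; exact i.elim0⟩
    have hz : (fun z => β z (i.succ.removeNth (Fin.cons a u : Fin (k + 1) → E))) =ᶠ[𝓝 y]
        fun _ => (0 : ℝ) := by
      filter_upwards [h] with z hz
      refine hz _ 0 ?_
      simp [Fin.removeNth]
    rw [hz.fderiv_eq, fderiv_fun_const]
    simp

end Sections

namespace LieGroupoid

section IdentityComponent

variable {E : Type*} [NormedAddCommGroup E] [NormedSpace ℝ E]
  {E' : Type*} [NormedAddCommGroup E'] [NormedSpace ℝ E']
  {M : Type*} [TopologicalSpace M] [ChartedSpace E M]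
  {G : Type*} [TopologicalSpace G] [ChartedSpace E' G]
  (𝒢 : LieGroupoid E E' M G) {k : ℕ}

theorem mem_leaf_self (x : M) : x ∈ 𝒢.leaf x :=
  ⟨_, @mem_connectedComponent _ (𝒢.orbitTopology x) _, 𝒢.tgt_unit x⟩

/-- A curve in the source fiber with velocity `a` is mapped by `t` to a curve that is continuous in
the orbit topology, so it stays in the leaf. -/
theorem D_tgt_mem_leafTangentSpace {x : M} {a : E'} (ha : D E' E 𝒢.src (𝒢.unit x) a = 0) :
    (D E' E 𝒢.tgt (𝒢.unit x) a : E) ∈ leafTangentSpace E (𝒢.leaf x) x := by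
  obtain ⟨c, hc, hc0, hcs, hca⟩ := exists_curve_in_fiber 𝒢.submersion_src ha
  have hcs' : ∀ τ, 𝒢.src (c τ) = x := fun τ => (hcs τ).trans (𝒢.src_unit x)
  have hD := D_comp (𝒢.smooth_tgt.mdifferentiable (by simp) _) (hc.mdifferentiable (by simp) 0) hc0
  have hx : 𝒢.tgt (c 0) = x := by rw [hc0, 𝒢.tgt_unit]
  refine Submodule.subset_span ⟨fun τ => 𝒢.tgt (c τ), 𝒢.smooth_tgt.comp hc, fun τ => ?_, ?_⟩
  · let := 𝒢.orbitTopology x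
    let q : ℝ → 𝒢.orbit x := fun τ => 𝒢.toOrbit x ⟨c τ, hcs' τ⟩
    have hq : Continuous q := (𝒢.isOpenQuotientMap_toOrbit x).continuous.comp (hc.continuous.subtype_mk _)
    have hq0 : q 0 = 𝒢.toOrbit x ⟨𝒢.unit x, 𝒢.src_unit x⟩ :=
      congrArg (𝒢.toOrbit x) (Subtype.ext hc0)
    refine ⟨q τ, ?_, rfl⟩
    rw [← hq0]
    exact (isPreconnected_range hq).subset_connectedComponent ⟨0, rfl⟩ ⟨τ, rfl⟩
  · have h1 : D ℝ E (fun τ => 𝒢.tgt (c τ)) 0 1 = D E' E 𝒢.tgt (𝒢.unit x) a := by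
      rw [hD, ContinuousLinearMap.comp_apply, hca]
    have h2 : ∀ {p q : M} {w w' : E}, p = q → w = w' →
        (⟨p, w⟩ : TangentBundle 𝓘(ℝ, E) M) = ⟨q, w'⟩ := by
      rintro p _ w _ rfl rfl
      rfl
    exact h2 hx h1

variable [IsManifold 𝓘(ℝ, E) ∞ M] [IsManifold 𝓘(ℝ, E') ∞ G]

/-- Each vector at a unit that is tangent to the source fiber gives rise to a smooth local section
of the distribution. -/
theorem exists_section_distribution {x : M} {a : E'} (ha : D E' E 𝒢.src (𝒢.unit x) a = 0) :
    ∃ (U : Set M) (X : ∀ x : M, TangentSpace 𝓘(ℝ, E) x), IsOpen U ∧ x ∈ U ∧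
      ContMDiffOn 𝓘(ℝ, E) (𝓘(ℝ, E).prod 𝓘(ℝ, E)) ∞
        (fun x => (⟨x, X x⟩ : TangentBundle 𝓘(ℝ, E) M)) U ∧
      (∀ x ∈ U, X x ∈ distribution E 𝒢.foliation x) ∧
      (X x : E) = D E' E 𝒢.tgt (𝒢.unit x) a := by
  set ψ := chartAt E' (𝒢.unit x)
  have hψ : ψ ∈ IsManifold.maximalAtlas 𝓘(ℝ, E') ∞ G := IsManifold.chart_mem_maximalAtlas _
  have hxψ : 𝒢.unit x ∈ ψ.source := mem_chart_source E' _
  let U : Set M := 𝒢.unit ⁻¹' ψ.source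
  let c : E' := D E' E' ψ (𝒢.unit x) a
  have hψs := contMDiffOn_symm_of_mem_maximalAtlas hψ
  have hr : ContMDiffOn 𝓘(ℝ, E) 𝓘(ℝ, E') ∞ (fun z => ψ (𝒢.unit z)) U :=
    (contMDiffOn_of_mem_maximalAtlas hψ).comp 𝒢.smooth_unit.contMDiffOn fun _ h => h
  have hrU : MapsTo (fun z => ψ (𝒢.unit z)) U ψ.target := fun z hz => ψ.map_source hz
  have hX1 := contMDiffOn_pushforward_const ψ.open_target (𝒢.smooth_tgt.comp_contMDiffOn hψs) hr hrU
    (fun z hz => by simp only [Function.comp, ψ.left_inv hz, 𝒢.tgt_unit]) c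
  have hX2 := contMDiffOn_pushforward_const ψ.open_target (𝒢.smooth_src.comp_contMDiffOn hψs) hr hrU
    (fun z hz => by simp only [Function.comp, ψ.left_inv hz, 𝒢.src_unit]) c
  let A : M → E' := fun z => D E' E' ψ.symm (ψ (𝒢.unit z)) c
  have hDt : ∀ z ∈ U, D E' E (𝒢.tgt ∘ ψ.symm) (ψ (𝒢.unit z)) c =
      D E' E 𝒢.tgt (𝒢.unit z) (A z) := fun z hz =>
    DFunLike.congr_fun (D_comp (𝒢.smooth_tgt.mdifferentiable (by simp) _)
      ((mdifferentiable_of_mem_maximalAtlas hψ).mdifferentiableAt_symm (hrU hz))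
      (ψ.left_inv hz)) c
  have hDs : ∀ z ∈ U, D E' E (𝒢.src ∘ ψ.symm) (ψ (𝒢.unit z)) c =
      D E' E 𝒢.src (𝒢.unit z) (A z) := fun z hz =>
    DFunLike.congr_fun (D_comp (𝒢.smooth_src.mdifferentiable (by simp) _)
      ((mdifferentiable_of_mem_maximalAtlas hψ).mdifferentiableAt_symm (hrU hz))
      (ψ.left_inv hz)) c
  -- Let `A` extend `a` along the units, constant in the chart. The correction `A - du(ds A)` is
  -- tangent to source fibers, and `dt` maps it to `dt A - ds A` since `t ∘ u = id`. At `x` the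
  -- second term vanishes.
  refine ⟨U, fun z => (D E' E (𝒢.tgt ∘ ψ.symm) (ψ (𝒢.unit z)) c -
    D E' E (𝒢.src ∘ ψ.symm) (ψ (𝒢.unit z)) c : E), ψ.open_source.preimage 𝒢.smooth_unit.continuous,
    hxψ, ContMDiffOn.sub_section hX1 hX2, fun z hz => ?_, ?_⟩
  · refine ⟨𝒢.leaf z, ⟨z, rfl⟩, ?_⟩
    have hu := 𝒢.smooth_unit.mdifferentiable (n := ∞) (by simp) z
    have hsu := D_comp (𝒢.smooth_src.mdifferentiable (n := ∞) (by simp) _) hu rfl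
    have htu := D_comp (𝒢.smooth_tgt.mdifferentiable (n := ∞) (by simp) _) hu rfl
    simp only [𝒢.src_unit, 𝒢.tgt_unit, D_id] at hsu htu
    have hs : D E' E 𝒢.src (𝒢.unit z)
        (A z - D E E' 𝒢.unit z (D E' E 𝒢.src (𝒢.unit z) (A z))) = 0 := by
      rw [map_sub, ← ContinuousLinearMap.comp_apply (D E' E 𝒢.src _) (D E E' 𝒢.unit z), ← hsu,
        ContinuousLinearMap.id_apply, sub_self]
    have ht := 𝒢.D_tgt_mem_leafTangentSpace hs
    rw [map_sub, ← ContinuousLinearMap.comp_apply (D E' E 𝒢.tgt _) (D E E' 𝒢.unit z), ← htu,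
        ContinuousLinearMap.id_apply, ← hDt z hz, ← hDs z hz] at ht
    exact ⟨𝒢.mem_leaf_self z, ht⟩
  · change D E' E (𝒢.tgt ∘ ψ.symm) (ψ (𝒢.unit x)) c -
      D E' E (𝒢.src ∘ ψ.symm) (ψ (𝒢.unit x)) c = _
    rw [hDt x hxψ, hDs x hxψ, show A x = a from D_symm_D hψ hxψ a, ha, sub_zero]

variable {𝒢}

omit [IsManifold 𝓘(ℝ, E) ∞ M] [IsManifold 𝓘(ℝ, E') ∞ G] in
-- By right translation, the vectors `dt(a)` at an arrow already occur at the unit of its target.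
theorem isHorizontal_of_unit {β : Form E M k} (h : ∀ x a, D E' E 𝒢.src (𝒢.unit x) a = 0 →
    D E' E 𝒢.tgt (𝒢.unit x) a ∈ β.radical x) : 𝒢.IsHorizontal β := by
  intro g a ha
  obtain ⟨b, hb, hba⟩ := 𝒢.exists_unit_vector ha
  exact hba ▸ h _ b hb

/-- Forms that are basic for the foliation are horizontal, and so are their exterior derivatives. -/
theorem isHorizontal_of_isFoliationBasic {α : Form E M k}
    (h : IsFoliationBasic 𝒢.foliation α) : 𝒢.IsHorizontal α ∧ 𝒢.IsHorizontal α.d := by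
  have key : ∀ x a, D E' E 𝒢.src (𝒢.unit x) a = 0 →
      D E' E 𝒢.tgt (𝒢.unit x) a ∈ α.radical x ∧ D E' E 𝒢.tgt (𝒢.unit x) a ∈ α.d.radical x := by
    intro x a ha
    obtain ⟨U, X, hU, hx, hXs, hXd, hXx⟩ := 𝒢.exists_section_distribution ha
    have hb := h U X hU hXs hXd
    rw [← hXx]
    -- For functions the radical is everything and `L_X α` is `ι_X dα` by definition. In positive
    -- degree `ι_X α` vanishes on all of `U`, hence so does `d(ι_X α)`, and Cartan's formula leaves
    -- `ι_X dα = 0`.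
    cases k with
    | zero => exact ⟨fun _ i => i.elim0, Form.mem_radical_iff_contract.2 (hb x hx).2⟩
    | succ k =>
      refine ⟨Form.mem_radical_iff_contract.2 (hb x hx).1, Form.mem_radical_iff_contract.2 ?_⟩
      have h1 : α.d.contract X x + (α.contract X).d x = 0 := (hb x hx).2
      rwa [Form.d_eq_zero_of_eqOn_zero hU (fun y hy => (hb y hy).1) hx, add_zero] at h1
  exact ⟨isHorizontal_of_unit fun x a ha => (key x a ha).1,
    isHorizontal_of_unit fun x a ha => (key x a ha).2⟩

omit [IsManifold 𝓘(ℝ, E) ∞ M] [IsManifold 𝓘(ℝ, E') ∞ G] in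
/-- At the units, horizontal forms have the same pullbacks by the source and target maps. -/
theorem IsHorizontal.pullback_eq_at_unit {β : Form E M k} (h : 𝒢.IsHorizontal β) (x : M) :
    Form.pullback (E' := E') 𝒢.src β (𝒢.unit x) = Form.pullback (E' := E') 𝒢.tgt β (𝒢.unit x) := by
  change (Form.pullback (E' := E') 𝒢.src β).eval (𝒢.unit x) =
    (Form.pullback (E' := E') 𝒢.tgt β).eval (𝒢.unit x)
  have hu := 𝒢.smooth_unit.mdifferentiable (n := ∞) (by simp) x
  have hsu := D_comp (𝒢.smooth_src.mdifferentiable (n := ∞) (by simp) _) hu rfl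
  have htu := D_comp (𝒢.smooth_tgt.mdifferentiable (n := ∞) (by simp) _) hu rfl
  simp only [𝒢.src_unit, 𝒢.tgt_unit, D_id] at hsu htu
  rw [Form.pullback_eval, Form.pullback_eval, 𝒢.src_unit, 𝒢.tgt_unit]
  ext v
  refine (Form.eval_congr_of_sub_mem_radical
    (v := fun i => D E' E 𝒢.tgt (𝒢.unit x) (v i))
    (w := fun i => D E' E 𝒢.src (𝒢.unit x) (v i)) fun i => ?_).symm
  -- Since `s ∘ u = t ∘ u = id`, the vector `v - du(ds v)` is tangent to the source fiber and `dt`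
  -- maps it to `dt v - ds v`.
  have hs : D E' E 𝒢.src (𝒢.unit x)
      (v i - D E E' 𝒢.unit x (D E' E 𝒢.src (𝒢.unit x) (v i))) = 0 := by
    rw [map_sub, ← ContinuousLinearMap.comp_apply (D E' E 𝒢.src _) (D E E' 𝒢.unit x), ← hsu,
      ContinuousLinearMap.id_apply, sub_self]
  have ht := h _ _ hs
  rw [map_sub, ← ContinuousLinearMap.comp_apply (D E' E 𝒢.tgt _) (D E E' 𝒢.unit x), ← htu,
    ContinuousLinearMap.id_apply, 𝒢.tgt_unit] at ht
  exact ht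

omit [IsManifold 𝓘(ℝ, E') ∞ G] in
/-- Coordinate expressions of pullbacks of horizontal forms with horizontal exterior derivatives
are constant along source fibers. -/
theorem pullback_inChart_fiberMap {α : Form E M k} (hα : α.IsSmooth) {f : G → M}
    (hf : ContMDiff 𝓘(ℝ, E') 𝓘(ℝ, E) ∞ f)
    (h : ∀ g a, D E' E 𝒢.src g a = 0 → D E' E f g a ∈ α.radical (f g))
    (hd : ∀ g a, D E' E 𝒢.src g a = 0 → D E' E f g a ∈ α.d.radical (f g))
    {g : G} (C : SubmersionChart E E' 𝒢.src g) {ε : ℝ}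
    (hε : Metric.ball (0 : C.proj.ker) ε ⊆ C.fiberDomain) {w : C.proj.ker}
    (hw : w ∈ Metric.ball (0 : C.proj.ker) ε) :
    (Form.pullback f α).inChart C.dom (C.dom g + w) =
      (Form.pullback f α).inChart C.dom (C.dom g) := by
  set β := (Form.pullback f α).inChart C.dom with hβ
  -- In the adapted chart, vectors in the kernel of the projection are tangent to source fibers, so
  -- they annihilate the pullbacks of both `α` and `dα`.
  have hzero : ∀ {l : ℕ} (η : Form E M l),
      (∀ g a, D E' E 𝒢.src g a = 0 → D E' E f g a ∈ η.radical (f g)) →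
      ∀ y ∈ C.dom.target, ∀ a, C.proj a = 0 → ∀ v i, v i = a →
        (Form.pullback f η).inChart C.dom y v = 0 := by
    intro l η hη y hy a ha v i hvi
    rw [Form.inChart_eq, Form.pullback_eval]
    exact hη _ _ ((C.D_symm_eq_zero_iff 𝒢.smooth_src hy a).2 ha) _ i (by rw [← hvi]; rfl)
  ext u
  have hder : ∀ w' ∈ Metric.ball (0 : C.proj.ker) ε,
      HasFDerivAt (fun w' : C.proj.ker => β (C.dom g + w') u) (0 : C.proj.ker →L[ℝ] ℝ) w' := by
    intro w' hw'
    have hy : C.dom g + w' ∈ C.dom.target := hε hw'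
    have hdiff : DifferentiableAt ℝ β (C.dom g + w') :=
      hα.differentiableAt_pullback_inChart C.dom_mem hf hy
    have hdu : DifferentiableAt ℝ (fun y => β y u) (C.dom g + w') :=
      hdiff.continuousAlternatingMap_apply_const u
    have hin : HasFDerivAt (fun w : C.proj.ker => C.dom g + (w : E')) C.proj.ker.subtypeL w' :=
      C.proj.ker.subtypeL.hasFDerivAt.const_add _
    have hcomp := HasFDerivAt.comp w' (f := fun w : C.proj.ker => C.dom g + (w : E'))
      hdu.hasFDerivAt hin
    refine hcomp.congr_fderiv ?_
    ext a
    refine fderiv_apply_eq_zero_of_extDeriv hdiff ?_ ?_ u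
    · filter_upwards [C.dom.open_target.mem_nhds hy] with z hz
      exact hzero α h z hz a a.2
    · intro v i hvi
      rw [hβ, ← Form.pullback_d_inChart C.dom_mem hf hα hy]
      exact hzero α.d hd _ hy a a.2 v i hvi
  have hε0 : 0 < ε := lt_of_le_of_lt dist_nonneg hw
  have hconst := Metric.isOpen_ball.is_const_of_fderiv_eq_zero (𝕜 := ℝ)
    (convex_ball (0 : C.proj.ker) ε).isPreconnected
    (fun w' hw' => (hder w' hw').differentiableAt.differentiableWithinAt)
    (fun w' hw' => (hder w' hw').fderiv) hw (Metric.mem_ball_self hε0)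
  simpa using hconst

omit [IsManifold 𝓘(ℝ, E') ∞ G] in
/-- The arrows of a source fiber at which the pullbacks by the source and target maps of a
horizontal form with horizontal exterior derivative agree form an open and closed set. -/
theorem IsHorizontal.eventually_pullback_eq_iff {α : Form E M k} (hα : α.IsSmooth)
    (h : 𝒢.IsHorizontal α) (hd : 𝒢.IsHorizontal α.d) (g : G) :
    ∀ᶠ g' in 𝓝[𝒢.src ⁻¹' {𝒢.src g}] g,
      Form.pullback (E' := E') 𝒢.src α g' = Form.pullback (E' := E') 𝒢.tgt α g' ↔
      Form.pullback (E' := E') 𝒢.src α g = Form.pullback (E' := E') 𝒢.tgt α g := by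
  obtain ⟨C⟩ := nonempty_submersionChart 𝒢.submersion_src g
  obtain ⟨ε, hε, hball⟩ := Metric.isOpen_iff.1 C.isOpen_fiberDomain 0 C.zero_mem_fiberDomain
  obtain ⟨U, hU, hUW⟩ := C.exists_isOpen_inter_fiber Metric.isOpen_ball hball
  have hgU : g ∈ U := by
    have : g ∈ U ∩ 𝒢.src ⁻¹' {𝒢.src g} := hUW ▸ ⟨0, Metric.mem_ball_self hε, C.fiberMap_zero⟩
    exact this.1
  have hiff : ∀ g' ∈ C.dom.source,
      Form.pullback (E' := E') 𝒢.src α g' = Form.pullback (E' := E') 𝒢.tgt α g' ↔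
      (Form.pullback 𝒢.src α).inChart C.dom (C.dom g') =
        (Form.pullback 𝒢.tgt α).inChart C.dom (C.dom g') := by
    intro g' hg'
    refine ⟨fun h => ?_, Form.eq_of_inChart_eq C.dom_mem hg'⟩
    have h' : (Form.pullback (E' := E') 𝒢.src α).eval g' =
      (Form.pullback (E' := E') 𝒢.tgt α).eval g' := h
    rw [Form.inChart_eq, Form.inChart_eq, C.dom.left_inv hg', h']
  filter_upwards [mem_nhdsWithin_of_mem_nhds (hU.mem_nhds hgU), self_mem_nhdsWithin] with g' h1 h2
  have : g' ∈ U ∩ 𝒢.src ⁻¹' {𝒢.src g} := ⟨h1, h2⟩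
  rw [hUW] at this
  obtain ⟨w, hw, rfl⟩ := this
  -- For the source map horizontality is automatic, as `ds a = 0`.
  have hs0 : ∀ {l : ℕ} (η : Form E M l), ∀ g a, D E' E 𝒢.src g a = 0 →
      D E' E 𝒢.src g a ∈ η.radical (𝒢.src g) := fun η g a ha => ha ▸ Submodule.zero_mem _
  have hw' : C.dom (C.fiberMap w) = C.dom g + w := C.dom.right_inv (hball hw)
  rw [hiff _ (C.fiberMap_mem_source (hball hw)), hiff g C.mem_source, hw',
    pullback_inChart_fiberMap hα 𝒢.smooth_src (hs0 α) (hs0 α.d) C hball hw,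
    pullback_inChart_fiberMap hα 𝒢.smooth_tgt h hd C hball hw]

/-- Forms that are basic for the foliation of a Lie groupoid are basic for its identity
component. -/
theorem isBasicOn_identityComponent {α : Form E M k} (hα : α.IsSmooth)
    (h : IsFoliationBasic 𝒢.foliation α) : 𝒢.IsBasicOn 𝒢.identityComponent α := by
  obtain ⟨h1, h2⟩ := isHorizontal_of_isFoliationBasic h
  intro g hg
  set x := 𝒢.src g with hx
  set S := connectedComponentIn (𝒢.src ⁻¹' {x}) (𝒢.unit x) with hS
  have hSsub : S ⊆ 𝒢.src ⁻¹' {x} := connectedComponentIn_subset _ _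
  have hunit : 𝒢.unit x ∈ S := mem_connectedComponentIn (𝒢.src_unit x)
  have hpre : PreconnectedSpace S :=
    isPreconnected_iff_preconnectedSpace.1 isPreconnected_connectedComponentIn
  let P : S → Prop := fun g =>
    Form.pullback (E' := E') 𝒢.src α g = Form.pullback (E' := E') 𝒢.tgt α g
  have hP : IsLocallyConstant P := by
    rw [IsLocallyConstant.iff_eventually_eq]
    intro g'
    have hev := h1.eventually_pullback_eq_iff hα h2 (g' : G)
    rw [show 𝒢.src g' = x from hSsub g'.2] at hev
    have hev' := hev.filter_mono (nhdsWithin_mono _ hSsub)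
    rw [nhdsWithin_eq_map_subtype_coe g'.2, eventually_map] at hev'
    exact hev'.mono fun g'' h => propext h
  have := hP.apply_eq_of_preconnectedSpace ⟨𝒢.unit x, hunit⟩ ⟨g, hg⟩
  exact this.mp (h1.pullback_eq_at_unit x)

omit [IsManifold 𝓘(ℝ, E) ∞ M] [IsManifold 𝓘(ℝ, E') ∞ G] in
theorem IsSourceConnected.mem_identityComponent (h : 𝒢.IsSourceConnected) (g : G) :
    g ∈ 𝒢.identityComponent :=
  (h (𝒢.src g)).isPreconnected.subset_connectedComponentIn (𝒢.src_unit _) subset_rfl rfl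

end IdentityComponent

end LieGroupoid

end SingFol

end

theorem proposition5
    {E : Type*} [NormedAddCommGroup E] [NormedSpace ℝ E] [FiniteDimensional ℝ E]
    {E' : Type*} [NormedAddCommGroup E'] [NormedSpace ℝ E'] [FiniteDimensional ℝ E']
    {M : Type*} [TopologicalSpace M] [T2Space M] [SecondCountableTopology M]
    [ChartedSpace E M] [IsManifold 𝓘(ℝ, E) ∞ M]
    {G : Type*} [TopologicalSpace G] [ChartedSpace E' G] [IsManifold 𝓘(ℝ, E') ∞ G]
    (𝒢 : SingFol.LieGroupoid E E' M G) {k : ℕ} (α : SingFol.Form E M k) (hα : α.IsSmooth) :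
    (𝒢.IsBasic α → SingFol.IsFoliationBasic 𝒢.foliation α) ∧
    (SingFol.IsFoliationBasic 𝒢.foliation α → 𝒢.IsBasicOn 𝒢.identityComponent α) ∧
    (𝒢.IsSourceConnected → (𝒢.IsBasic α ↔ SingFol.IsFoliationBasic 𝒢.foliation α)) :=
  ⟨fun h => h.isFoliationBasic hα, SingFol.LieGroupoid.isBasicOn_identityComponent hα,
    fun hc => ⟨fun h => h.isFoliationBasic hα, fun h => funext fun g =>
      SingFol.LieGroupoid.isBasicOn_identityComponent hα h g (hc.mem_identityComponent g)⟩⟩
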